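/- **Theorem 3.4.** Let $\mathbb F$ be an algebraically closed field of characteristic $0$. A *Novikov algebra* over $\mathbb F$ is an $\mathbb F$-vector space $\mathcal N$ with a bilinear operation $\circ$ such that, for all $u,v,w\in\mathcal N$, $$(u\circ v)\circ w=(u\circ w)\circ v,\qquad (u\circ v)\circ w-u\circ(v\circ w)=(v\circ u)\circ w-v\circ(u\circ w).$$ It is *simple* if $\mathcal N\circ\mathcal N\neq\{0\}$ and its only two-sided ideals (subspaces $I$ with $\mathcal N\circ I\subseteq I$ and $I\circ\mathcal N\subseteq I$) are $\{0\}$ and $\mathcal N$. Put $L_u(v)=u\circ v$ and $R_u(v)=v\circ u$. A linear operator $T$ on a vector space is *locally finite* if, for every vector $v$, the span of $\{T^m(v)\mid m\ge 0\}$ is finite-dimensional. For an additive subgroup $\Delta\subseteq\mathbb F$, an extension field $\mathbb F_1$ of $\mathbb F$, a set $J\in\{\{0\},\mathbb N\}$ (where $0\in\mathbb N$) and a symmetric two-cocycle $f$ of $\Delta$ with values in $\mathbb F_1^\times$, that is, a map $f:\Delta\times\Delta\to\mathbb F_1^\times$ with $$f(\alpha,\beta)f(\alpha+\beta,\gamma)=f(\alpha,\beta+\gamma)f(\beta,\gamma),\qquad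 f(\alpha,\beta)=f(\beta,\alpha)\qquad(\alpha,\beta,\gamma\in\Delta),$$ let $\mathcal A(\Delta,f,J)$ be the $\mathbb F_1$-vector space with basis $\{u_{\alpha,j}\mid \alpha\in\Delta,\ j\in J\}$, let $\cdot$ be the $\mathbb F_1$-bilinear product on it and $\partial$ the $\mathbb F_1$-linear map with $$u_{\alpha,i}\cdot u_{\beta,j}=f(\alpha,\beta)\,u_{\alpha+\beta,i+j},\qquad \partial(u_{\alpha,j})=\alpha\, u_{\alpha,j}+j\,u_{\alpha,j-1}$$ (the last term being $0$ for $j=0$). For $\xi\in\mathbb F$ let $$u\circ_\xi v=u\cdot\partial(v)+\xi\,(u\cdot v).$$ Let $(\mathcal N,\circ)$ be an infinite-dimensional simple Novikov algebra over $\mathbb F$ with an element $e$ such that $L_e$ is locally finite, $R_e=b\,\mathrm{Id}_{\mathcal N}$ for some $b\in\mathbb F$, and $L_e$ is surjective if $R_e=0$. Then there exist an additive subgroup $\Delta$ of $\mathbb F$, an extension field $\mathbb F_1$ of $\mathbb F$, a symmetric two-cocycle $f$ of $\Delta$ with values in $\mathbb F_1^\times$, a set $J\in\{\{0\},\mathbb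 N\}$ and an element $\xi\in\mathbb F$ such that $(\mathcal N,\circ)$ is isomorphic, as an algebra over $\mathbb F$, to $(\mathcal A(\Delta,f,J),\circ_\xi)$. -/

import Mathlib

universe u v

noncomputable section

namespace Novikov

/-- A left-symmetric algebra is a Novikov algebra if its right multiplications commute. Left symmetry
`(u ∘ v) ∘ w - u ∘ (v ∘ w) = (v ∘ u) ∘ w - v ∘ (u ∘ w)` is the axiom of `LeftPreLieRing`, and
bilinearity over the base ring is `LeftPreLieAlgebra`. The operation `∘` is written `*`. -/
def IsNovikov (N : Type*) [LeftPreLieRing N] : Prop :=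
  ∀ u v w : N, (u * v) * w = (u * w) * v

/-- Simplicity: the only subspaces that are both left and right ideals are `0` and `N`, and
`N ∘ N ≠ 0`. -/
def IsSimple (F N : Type*) [Field F] [LeftPreLieRing N] [LeftPreLieAlgebra F N] : Prop :=
  (∀ I : Submodule F N, (∀ u : N, ∀ v ∈ I, u * v ∈ I ∧ v * u ∈ I) → I = ⊥ ∨ I = ⊤) ∧
    ∃ u v : N, u * v ≠ 0

/-- A linear operator `T` is locally finite if for every `v` the span of all `T ^ m v`, `m ≥ 0`, is
finite-dimensional. -/
def IsLocallyFinite {F V : Type*} [Field F] [AddCommGroup V] [Module F V] (T : V →ₗ[F] V) : Prop :=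
  ∀ v : V, FiniteDimensional F (Submodule.span F (Set.range fun m : ℕ => (T ^ m) v))

/-- Symmetric two-cocycles of an additive abelian group `G` with values in the multiplicative group
of a field. -/
structure IsSymmTwoCocycle {G F₁ : Type*} [AddCommGroup G] [Field F₁] (f : G → G → F₁ˣ) :
    Prop where
  cocycle : ∀ a b c : G, f a b * f (a + b) c = f a (b + c) * f b c
  symm : ∀ a b : G, f a b = f b a

section Model

variable {F : Type*} [Field F] (Δ : AddSubgroup F) (F₁ : Type*) [Field F₁] [Algebra F F₁]

/-- The `F₁`-vector space with basis `u_{α,j} = Finsupp.single (α, j) 1`, `(α, j) ∈ Δ × ℕ`; it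
carries the algebra `A(Δ, f, ℕ)`. -/
abbrev Ambient : Type _ := (Δ × ℕ) →₀ F₁

/-- The subspace spanned by the `u_{α,j}` with `α ∈ Δ` and `j ∈ J`; it carries `A(Δ, f, J)`. -/
abbrev A (J : Set ℕ) : Submodule F₁ (Ambient Δ F₁) :=
  Finsupp.supported F₁ F₁ {p : Δ × ℕ | p.2 ∈ J}

variable {Δ F₁}

/-- The `F₁`-bilinear product with `u_{α,i} · u_{β,j} = f(α,β) u_{α+β,i+j}`. -/
def dot (f : Δ → Δ → F₁ˣ) : Ambient Δ F₁ →ₗ[F₁] Ambient Δ F₁ →ₗ[F₁] Ambient Δ F₁ :=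
  Finsupp.linearCombination F₁ fun p : Δ × ℕ =>
    Finsupp.linearCombination F₁ fun q : Δ × ℕ => Finsupp.single (p + q) (f p.1 q.1 : F₁)

variable (Δ F₁) in
/-- The `F₁`-linear map with `∂ u_{α,j} = α u_{α,j} + j u_{α,j-1}`. -/
def der : Ambient Δ F₁ →ₗ[F₁] Ambient Δ F₁ :=
  Finsupp.linearCombination F₁ fun p : Δ × ℕ =>
    Finsupp.single p (algebraMap F F₁ (p.1 : F)) + Finsupp.single (p.1, p.2 - 1) (p.2 : F₁)

/-- The operation `u ∘_ξ v = u · ∂ v + ξ (u · v)`, for a scalar `ξ ∈ F`. -/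
def circ (f : Δ → Δ → F₁ˣ) (ξ : F) (u v : Ambient Δ F₁) : Ambient Δ F₁ :=
  dot f u (der Δ F₁ v) + ξ • dot f u v

/-- For `J = {0}` and `J = ℕ`, the subspace `A(Δ, f, J)` is closed under `∘_ξ`. -/
theorem circ_mem (f : Δ → Δ → F₁ˣ) (ξ : F) {J : Set ℕ} (hJ : J = {0} ∨ J = Set.univ)
    {u v : Ambient Δ F₁} (hu : u ∈ A Δ F₁ J) (hv : v ∈ A Δ F₁ J) : circ f ξ u v ∈ A Δ F₁ J := by
  rcases hJ with rfl | rfl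
  · have hdot : ∀ x ∈ A Δ F₁ {0}, ∀ y ∈ A Δ F₁ {0}, dot f x y ∈ A Δ F₁ {0} := by
      intro x hx y hy
      rw [dot, Finsupp.linearCombination_apply, Finsupp.sum, LinearMap.sum_apply]
      refine Submodule.sum_mem _ fun p hp => Submodule.smul_mem _ _ ?_
      rw [Finsupp.linearCombination_apply]
      refine Submodule.sum_mem _ fun q hq => Submodule.smul_mem _ _ ?_
      refine Finsupp.single_mem_supported F₁ _ ?_
      have h1 : p.2 = 0 := hx hp
      have h2 : q.2 = 0 := hy hq
      simp [h1, h2]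
    have hder : der Δ F₁ v ∈ A Δ F₁ {0} := by
      rw [der, Finsupp.linearCombination_apply]
      refine Submodule.sum_mem _ fun p hp => Submodule.smul_mem _ _ ?_
      have h1 : p.2 = 0 := hv hp
      refine Submodule.add_mem _ (Finsupp.single_mem_supported F₁ _ h1)
        (Finsupp.single_mem_supported F₁ _ ?_)
      simp [h1]
    exact Submodule.add_mem _ (hdot u hu _ hder)
      (Submodule.smul_of_tower_mem _ ξ (hdot u hu v hv))
  · intro p _
    trivial

/-- The algebra operation `∘_ξ` on `A(Δ, f, J)`, where `J = {0}` or `J = ℕ`. -/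
def circA (f : Δ → Δ → F₁ˣ) (ξ : F) {J : Set ℕ} (hJ : J = {0} ∨ J = Set.univ)
    (u v : A Δ F₁ J) : A Δ F₁ J :=
  ⟨circ f ξ u v, circ_mem f ξ hJ u.2 v.2⟩

end Model

end Novikov

end

/-! The right multiplications commute and generate, together with the scalars, a commutative algebra
`C` of operators on `N`; by left symmetry, commutation with the left multiplication by `u` is a
derivation `d u` of `C`. Suppose that `c ↦ c • e` is a bijection from `C` to `N`. Then the product
of `N` becomes `a · (δ c + b c)` with `δ = d e`, and simplicity of `N` leaves `C` without proper
`δ`-stable ideals (`RightMulData.isDifferentiallySimple`). An eigenvector of `δ` generates a stable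
ideal, so it is a unit. Hence the constants form a field `F₁`, the eigenvalues form a group `Δ`, a
choice of eigenvectors `u_α` defines a cocycle, and the generalized kernel of `δ` is `F₁` or `F₁[t]`
with `δ t = 1`. By local finiteness `C` is the sum of the translates of this kernel by the `u_α`,
which is the model (`exists_model`), with `ξ = b`.

It remains to find an `e` for which evaluation is bijective. If `b = 0`, surjectivity of the left
multiplication suffices. If `b ≠ 0`, evaluation is injective: its kernel is nilpotent, and a nonzero
nilradical would contain an element fixing `e` (`RightMulData.eq_zero_of_smul_unit_eq_zero`). If it
is not surjective, the weights of `d e` on `C` are natural multiples of `b`, and the generalized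
kernel of the left multiplication by `e` lowers them by `b`. That kernel then contains an element
that can replace `e` and has vanishing right multiplication
(`RightMulData.exists_mulRight_eq_zero`), which reduces everything to `b = 0`. -/

noncomputable section

namespace Novikov

/-! ### Generalized eigenspaces and local finiteness. -/

section GenEigenspace

open Module

variable {F V : Type*} [Field F] [AddCommGroup V] [Module F V]

/-- Induction on the exponent of `T - α` that kills `x`; it replaces explicit binomial expansions
everywhere below. -/
theorem maxGenEigenspace_induction {T : End F V} {α : F} {p : V → Prop} (h0 : p 0)
    (hstep : ∀ x ∈ T.maxGenEigenspace α, p (T x - α • x) → p x) :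
    ∀ x ∈ T.maxGenEigenspace α, p x := by
  intro x hx
  obtain ⟨k, hk⟩ := (End.mem_maxGenEigenspace _ _ _).1 hx
  induction k generalizing x with
  | zero => simp at hk; rwa [hk]
  | succ k ih =>
    refine hstep x hx (ih _ ?_ ?_)
    · refine (End.mem_maxGenEigenspace _ _ _).2 ⟨k, ?_⟩
      simpa [pow_succ] using hk
    · simpa [pow_succ] using hk

theorem mem_maxGenEigenspace_of_sub_mem {T : End F V} {α : F} {x : V}
    (h : T x - α • x ∈ T.maxGenEigenspace α) : x ∈ T.maxGenEigenspace α := by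
  obtain ⟨k, hk⟩ := (End.mem_maxGenEigenspace _ _ _).1 h
  refine (End.mem_maxGenEigenspace _ _ _).2 ⟨k + 1, ?_⟩
  simpa [pow_succ] using hk

theorem sub_mem_maxGenEigenspace {T : End F V} {α : F} {x : V}
    (h : x ∈ T.maxGenEigenspace α) : T x - α • x ∈ T.maxGenEigenspace α := by
  obtain ⟨k, hk⟩ := (End.mem_maxGenEigenspace _ _ _).1 h
  refine (End.mem_maxGenEigenspace _ _ _).2 ⟨k, ?_⟩
  have : ((T - α • (1 : End F V)) ^ (k + 1)) x = 0 := by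
    rw [pow_succ', Module.End.mul_apply, hk, map_zero]
  simpa [pow_succ] using this

theorem apply_mem_maxGenEigenspace {T : End F V} {α : F} {x : V}
    (h : x ∈ T.maxGenEigenspace α) : T x ∈ T.maxGenEigenspace α := by
  have := add_mem (sub_mem_maxGenEigenspace h) (Submodule.smul_mem _ α h)
  simpa using this

theorem mem_maxGenEigenspace_of_eigen {T : End F V} {α : F} {x : V}
    (h : T x = α • x) : x ∈ T.maxGenEigenspace α :=
  mem_maxGenEigenspace_of_sub_mem (by simp [h])

theorem exists_eigenvector_of_maxGenEigenspace_ne_bot {T : End F V} {α : F}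
    (h : T.maxGenEigenspace α ≠ ⊥) : ∃ x, x ≠ 0 ∧ T x = α • x := by
  by_contra! hc
  refine h ((Submodule.eq_bot_iff _).2 (maxGenEigenspace_induction rfl fun x _ hx => ?_))
  by_contra hne
  exact hc x hne (sub_eq_zero.1 hx)

theorem exists_preimage_of_mem_maxGenEigenspace {T : End F V} {α : F} (hα : α ≠ 0) :
    ∀ x ∈ T.maxGenEigenspace α, ∃ y ∈ T.maxGenEigenspace α, T y = x := by
  refine maxGenEigenspace_induction ⟨0, zero_mem _, map_zero _⟩ ?_
  rintro x hx ⟨y, hy, hyx⟩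
  refine ⟨α⁻¹ • (x - y), Submodule.smul_mem _ _ (sub_mem hx hy), ?_⟩
  rw [map_smul, map_sub, hyx, sub_sub_cancel, smul_smul, inv_mul_cancel₀ hα, one_smul]

/-- A linear map intertwining two operators up to a scalar shift respects generalized
eigenspaces. -/
theorem map_mem_maxGenEigenspace {W : Type*} [AddCommGroup W] [Module F W] {T : End F V}
    {S : End F W} (g : V →ₗ[F] W) {β : F} (h : ∀ x, S (g x) = g (T x) + β • g x) (α : F) :
    ∀ x ∈ T.maxGenEigenspace α, g x ∈ S.maxGenEigenspace (α + β) := by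
  refine maxGenEigenspace_induction (by simp) fun x _ hx => mem_maxGenEigenspace_of_sub_mem ?_
  convert hx using 1
  rw [h, map_sub, map_smul]
  module

/-- Generalized eigenspaces are multiplicative with respect to a bilinear map satisfying the
Leibniz rule. -/
theorem bilin_mem_maxGenEigenspace {X Y Z : Type*} [AddCommGroup X] [Module F X] [AddCommGroup Y]
    [Module F Y] [AddCommGroup Z] [Module F Z] (B : X →ₗ[F] Y →ₗ[F] Z) {T : End F X}
    {S : End F Y} {U : End F Z} (h : ∀ x y, U (B x y) = B (T x) y + B x (S y)) (α β : F) :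
    ∀ x ∈ T.maxGenEigenspace α, ∀ y ∈ S.maxGenEigenspace β,
      B x y ∈ U.maxGenEigenspace (α + β) := by
  refine maxGenEigenspace_induction (by simp) fun x _ ihx => ?_
  refine maxGenEigenspace_induction (by simp) fun y hy ihy => ?_
  refine mem_maxGenEigenspace_of_sub_mem ?_
  have := add_mem (ihx y hy) ihy
  convert this using 1
  rw [h]
  simp only [map_sub, map_smul, LinearMap.sub_apply, LinearMap.smul_apply]
  module

/-- Each vector lies in a finite-dimensional stable subspace, where the decomposition holds over an
algebraically closed field. -/
theorem iSup_maxGenEigenspace_eq_top_of_isLocallyFinite [IsAlgClosed F] {T : End F V}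
    (hT : IsLocallyFinite T) : ⨆ α : F, T.maxGenEigenspace α = ⊤ := by
  rw [eq_top_iff]
  intro v _
  set W := Submodule.span F (Set.range fun m : ℕ => (T ^ m) v) with hW
  have hfin : FiniteDimensional F W := hT v
  have hmap : ∀ x ∈ W, T x ∈ W := by
    intro x hx
    induction hx using Submodule.span_induction with
    | mem x h =>
      obtain ⟨m, rfl⟩ := h
      exact Submodule.subset_span ⟨m + 1, by simp [pow_succ']⟩
    | zero => simp
    | add x y _ _ hx hy => rw [map_add]; exact add_mem hx hy
    | smul a x _ hx => rw [map_smul]; exact Submodule.smul_mem _ _ hx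
  have hvW : v ∈ W := Submodule.subset_span ⟨0, by simp⟩
  have htop := End.iSup_maxGenEigenspace_eq_top (T.restrict hmap)
  have : (⟨v, hvW⟩ : W) ∈ ⨆ α : F, End.maxGenEigenspace (T.restrict hmap) α := by
    rw [htop]; trivial
  have h2 : v ∈ (⨆ α : F, End.maxGenEigenspace (T.restrict hmap) α).map W.subtype := ⟨_, this, rfl⟩
  rw [Submodule.map_iSup] at h2
  revert h2
  apply iSup_mono (α := Submodule F V)
  rintro α _ ⟨x, hx, rfl⟩
  simpa using map_mem_maxGenEigenspace (S := T) W.subtype (β := 0) (by simp) α x hx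

theorem isLocallyFinite_of_maxGenEigenspace_zero_eq_top {T : End F V}
    (hT : T.maxGenEigenspace 0 = ⊤) : IsLocallyFinite T := by
  intro v
  obtain ⟨k, hk⟩ := (End.mem_maxGenEigenspace _ _ _).1 (hT ▸ Submodule.mem_top : v ∈ _)
  rw [zero_smul, sub_zero] at hk
  have hsub : Set.range (fun m : ℕ => (T ^ m) v) ⊆
      insert 0 ((fun m : ℕ => (T ^ m) v) '' Set.Iio k) := by
    rintro _ ⟨m, rfl⟩
    by_cases hm : m < k
    · exact Or.inr ⟨m, hm, rfl⟩
    · left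
      obtain ⟨j, rfl⟩ := Nat.exists_eq_add_of_le' (not_lt.1 hm)
      simp [pow_add, hk]
  exact FiniteDimensional.span_of_finite F
    ((((Set.finite_Iio k).image _).insert 0).subset hsub)

end GenEigenspace

/-- In characteristic zero, derivations preserve nilpotency. -/
theorem isNilpotent_derivation {F A : Type*} [Field F] [CharZero F] [CommRing A] [Algebra F A]
    (δ : Derivation F A A) {c : A} (hc : IsNilpotent c) : IsNilpotent (δ c) := by
  obtain ⟨n, hn⟩ := hc
  -- Differentiating and multiplying by `δ c` trades one factor `c` for two factors `δ c`, up to a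
  -- nonzero integer and a multiple of the previous relation. At `k = n` only a power of `δ c` is
  -- left.
  have key : ∀ k ≤ n, c ^ (n - k) * δ c ^ (2 * k) = 0 := by
    intro k
    induction k with
    | zero => simp [hn]
    | succ k ih =>
      intro hk
      obtain ⟨m, rfl⟩ : ∃ m, n = m + (k + 1) := ⟨n - (k + 1), by omega⟩
      have h1 := ih (by omega)
      rw [show m + (k + 1) - k = m + 1 by omega] at h1
      rw [show m + (k + 1) - (k + 1) = m by omega]
      have h2 := congrArg (fun x => δ c * δ x) h1
      simp only [map_zero, mul_zero, Derivation.leibniz, Derivation.leibniz_pow, smul_eq_mul,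
        nsmul_eq_mul, Nat.add_sub_cancel] at h2
      have h3 : ((m + 1 : ℕ) : A) * (c ^ m * δ c ^ (2 * (k + 1))) = 0 := by
        rcases Nat.eq_zero_or_pos k with rfl | hk0
        · linear_combination h2
        · obtain ⟨j, rfl⟩ : ∃ j, k = j + 1 := ⟨k - 1, by omega⟩
          rw [show 2 * (j + 1) - 1 = 2 * j + 1 by omega] at h2
          push_cast at h2 ⊢
          linear_combination h2 - (2 * ((j : A) + 1)) * δ (δ c) * h1
      have h4 : (((m + 1 : ℕ) : F)⁻¹ * ((m + 1 : ℕ) : F)) • (c ^ m * δ c ^ (2 * (k + 1))) = 0 := by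
        rw [mul_smul, Nat.cast_smul_eq_nsmul F, nsmul_eq_mul, h3, smul_zero]
      rwa [inv_mul_cancel₀ (by exact_mod_cast Nat.succ_ne_zero m), one_smul] at h4
  exact ⟨2 * n, by simpa using key n le_rfl⟩

/-! ### Weights, units and slices in a differentially simple algebra. -/

section DifferentialAlgebra

open Module

variable {F B : Type*} [Field F] [CommRing B] [Algebra F B]

/-- The generalized eigenspace of a derivation. -/
abbrev weightSpace (δ : Derivation F B B) (α : F) : Submodule F B :=
  End.maxGenEigenspace (δ : B →ₗ[F] B) α

theorem mul_mem_weightSpace (δ : Derivation F B B) {α β : F} {x y : B}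
    (hx : x ∈ weightSpace δ α) (hy : y ∈ weightSpace δ β) : x * y ∈ weightSpace δ (α + β) := by
  refine bilin_mem_maxGenEigenspace (LinearMap.mul F B) (T := (δ : B →ₗ[F] B))
    (S := (δ : B →ₗ[F] B)) (fun x y => ?_) α β x hx y hy
  simp [Derivation.leibniz]
  ring

theorem one_mem_weightSpace (δ : Derivation F B B) : (1 : B) ∈ weightSpace δ 0 :=
  mem_maxGenEigenspace_of_eigen (by simp)

theorem mem_weightSpace_zero (δ : Derivation F B B) {x : B} (h : δ x ∈ weightSpace δ 0) :
    x ∈ weightSpace δ 0 :=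
  mem_maxGenEigenspace_of_sub_mem (by simpa using h)

theorem derivation_eigen_inv (δ : Derivation F B B) {u : Bˣ} {α : F}
    (h : δ u = α • (u : B)) : δ (↑u⁻¹ : B) = (-α) • (↑u⁻¹ : B) := by
  rw [δ.leibniz_of_mul_eq_one u.inv_mul, h]
  have := u.inv_mul
  simp only [smul_eq_mul, Algebra.smul_def, map_neg]
  linear_combination (-(↑u⁻¹ : B) * algebraMap F B α) * this

theorem derivation_eigen_mul (δ : Derivation F B B) {x y : B} {α β : F}
    (hx : δ x = α • x) (hy : δ y = β • y) : δ (x * y) = (α + β) • (x * y) := by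
  rw [δ.leibniz, hx, hy]
  simp only [smul_eq_mul, Algebra.smul_def, map_add]
  ring

variable (δ : Derivation F B B)

/-- The only `δ`-stable ideals are the trivial ones. -/
def IsDifferentiallySimple : Prop :=
  ∀ I : Ideal B, (∀ x ∈ I, δ x ∈ I) → I = ⊥ ∨ I = ⊤

variable {δ}

/-- The principal ideal generated by an eigenvector is `δ`-stable. -/
theorem isUnit_of_eigen (hs : IsDifferentiallySimple δ) {x : B} {α : F} (h : δ x = α • x)
    (h0 : x ≠ 0) : IsUnit x := by
  have hst : ∀ y ∈ Ideal.span {x}, δ y ∈ Ideal.span {x} := by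
    intro y hy
    obtain ⟨c, rfl⟩ := Ideal.mem_span_singleton.1 hy
    rw [δ.leibniz, h]
    refine Ideal.mem_span_singleton.2 ⟨δ c + algebraMap F B α * c, ?_⟩
    simp only [smul_eq_mul, Algebra.smul_def]
    ring
  rcases hs _ hst with hI | hI
  · exact absurd (Ideal.span_singleton_eq_bot.1 hI) h0
  · exact Ideal.span_singleton_eq_top.1 hI

/-- The additive group of eigenvalues of a derivation with invertible eigenvectors. -/
def weightGroup (δ : Derivation F B B) : AddSubgroup F where
  carrier := {α | ∃ u : Bˣ, δ u = α • (u : B)}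
  zero_mem' := ⟨1, by simp⟩
  add_mem' := by
    rintro α β ⟨u, hu⟩ ⟨v, hv⟩
    exact ⟨u * v, derivation_eigen_mul δ hu hv⟩
  neg_mem' := by
    rintro α ⟨u, hu⟩
    exact ⟨u⁻¹, derivation_eigen_inv δ hu⟩

theorem mem_weightGroup (hs : IsDifferentiallySimple δ) {α : F}
    (h : weightSpace δ α ≠ ⊥) : α ∈ weightGroup δ := by
  obtain ⟨x, hx0, hx⟩ := exists_eigenvector_of_maxGenEigenspace_ne_bot h
  obtain ⟨u, rfl⟩ := isUnit_of_eigen hs hx hx0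
  exact ⟨u, hx⟩

variable {F₁ : Type*} [Field F₁] [Algebra F₁ B]

theorem derivation_smul (hF : ∀ c : F₁, δ (algebraMap F₁ B c) = 0) (c : F₁) (x : B) :
    δ (c • x) = c • δ x := by
  rw [Algebra.smul_def, δ.leibniz, hF, smul_zero, add_zero, smul_eq_mul, Algebra.smul_def]

theorem smul_mem_weightSpace_zero (hF : ∀ c : F₁, δ (algebraMap F₁ B c) = 0) (c : F₁) {x : B}
    (hx : x ∈ weightSpace δ 0) : c • x ∈ weightSpace δ 0 := by
  rw [Algebra.smul_def]
  have h : algebraMap F₁ B c ∈ weightSpace δ 0 := mem_maxGenEigenspace_of_eigen (by simp [hF])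
  simpa using mul_mem_weightSpace δ h hx

theorem derivation_aeval (hF : ∀ c : F₁, δ (algebraMap F₁ B c) = 0) (t : B)
    (p : Polynomial F₁) :
    δ (Polynomial.aeval t p) = Polynomial.aeval t (Polynomial.derivative p) * δ t := by
  induction p using Polynomial.induction_on' with
  | add p q hp hq => simp [hp, hq, add_mul]
  | monomial n a =>
    simp only [Polynomial.aeval_monomial, Polynomial.derivative_monomial, map_mul, map_natCast,
      Derivation.leibniz, Derivation.leibniz_pow, hF, smul_eq_mul, nsmul_eq_mul]
    ring

/-- Differentiating an algebraic relation for `t` gives a relation of smaller degree, so in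
characteristic zero only constant polynomials remain. -/
theorem transcendental_of_derivation_eq_one [Nontrivial B] [CharZero F₁]
    (hF : ∀ c : F₁, δ (algebraMap F₁ B c) = 0) {t : B} (ht : δ t = 1) : Transcendental F₁ t := by
  rw [transcendental_iff]
  intro p
  induction hn : p.natDegree using Nat.strong_induction_on generalizing p with
  | _ n ih =>
    intro hp
    have hd : Polynomial.aeval t (Polynomial.derivative p) = 0 := by
      have := derivation_aeval hF t p
      rw [hp, map_zero, ht, mul_one] at this
      exact this.symm
    have h0 : p.natDegree = 0 := by
      by_contra hne
      have := ih _ (hn ▸ Polynomial.natDegree_derivative_lt hne) _ rfl hd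
      exact hne (Polynomial.derivative_eq_zero.1 this)
    rw [Polynomial.eq_C_of_natDegree_eq_zero h0] at hp ⊢
    rw [Polynomial.aeval_C, FaithfulSMul.algebraMap_eq_zero_iff] at hp
    rw [hp, map_zero]

/-- A slice for `δ`: either `δ t = 1`, and all powers of `t` are used, or the kernel of `δ` is
its generalized kernel, and only `t ^ 0` is used. -/
def IsSlice (δ : Derivation F B B) (J : Set ℕ) (t : B) : Prop :=
  (J = {0} ∧ ∀ a, δ (δ a) = 0 → δ a = 0) ∨ (J = Set.univ ∧ δ t = 1)

/-- If `δ (δ a) = 0` but `δ a ≠ 0`, then `δ a` is an invertible constant and `t = a / δ a` has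
derivative `1`. Otherwise `t` is irrelevant, and `0` is a placeholder. -/
theorem exists_isSlice (hs : IsDifferentiallySimple δ) : ∃ J t, IsSlice δ J t := by
  by_cases h : ∀ a, δ (δ a) = 0 → δ a = 0
  · exact ⟨{0}, 0, Or.inl ⟨rfl, h⟩⟩
  · push Not at h
    obtain ⟨a, ha, ha0⟩ := h
    obtain ⟨u, hu⟩ := isUnit_of_eigen (α := 0) hs (by simpa using ha) ha0
    refine ⟨Set.univ, ↑u⁻¹ * a, Or.inr ⟨rfl, ?_⟩⟩
    have h1 : δ (↑u⁻¹ : B) = 0 := by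
      simpa using derivation_eigen_inv (α := 0) δ (u := u) (by simp [hu, ha])
    simp [h1, ← hu]

theorem IsSlice.zero_mem {J : Set ℕ} {t : B} (h : IsSlice δ J t) : 0 ∈ J := by
  rcases h with ⟨rfl, _⟩ | ⟨rfl, _⟩ <;> simp

theorem IsSlice.pow_mem {J : Set ℕ} {t : B} (h : IsSlice δ J t) {j : ℕ} (hj : j ∈ J) :
    t ^ j ∈ weightSpace δ 0 := by
  rcases h with ⟨rfl, _⟩ | ⟨rfl, ht⟩
  · obtain rfl : j = 0 := hj
    simpa using one_mem_weightSpace δ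
  · have h1 : t ∈ weightSpace δ 0 := mem_weightSpace_zero δ (ht ▸ one_mem_weightSpace δ)
    clear hj
    induction j with
    | zero => simpa using one_mem_weightSpace δ
    | succ j ih => simpa [pow_succ] using mul_mem_weightSpace δ ih h1

theorem IsSlice.linearIndepOn [Nontrivial B] [CharZero F₁] {J : Set ℕ} {t : B}
    (h : IsSlice δ J t) (hF : ∀ c : F₁, δ (algebraMap F₁ B c) = 0) :
    LinearIndepOn F₁ (fun j : ℕ => t ^ j) J := by
  rcases h with ⟨rfl, _⟩ | ⟨rfl, ht⟩
  · exact LinearIndepOn.singleton (by simp)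
  · rw [linearIndepOn_univ_iff]
    have h := (Polynomial.basisMonomials F₁).linearIndependent.map'
      (Polynomial.aeval t).toLinearMap (LinearMap.ker_eq_bot'.2
        (transcendental_iff.1 (transcendental_of_derivation_eq_one hF ht)))
    have he : (fun j : ℕ => t ^ j) =
        (Polynomial.aeval t).toLinearMap ∘ Polynomial.basisMonomials F₁ := by
      ext j
      simp
    rwa [he]

theorem IsSlice.mem_span [CharZero F₁] {J : Set ℕ} {t : B}
    (h : IsSlice δ J t) (hF : ∀ c : F₁, δ (algebraMap F₁ B c) = 0)
    (hker : ∀ a, δ a = 0 → ∃ c, algebraMap F₁ B c = a) :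
    ∀ x ∈ weightSpace δ 0, x ∈ Submodule.span F₁ ((fun j : ℕ => t ^ j) '' J) := by
  have hker' : ∀ a, δ a = 0 → a ∈ Submodule.span F₁ ((fun j : ℕ => t ^ j) '' J) := by
    intro a ha
    obtain ⟨c, rfl⟩ := hker a ha
    rw [Algebra.algebraMap_eq_smul_one]
    exact Submodule.smul_mem _ _ (Submodule.subset_span ⟨0, h.zero_mem, pow_zero t⟩)
  refine maxGenEigenspace_induction (Submodule.zero_mem _) fun x _ hx => ?_
  rw [zero_smul, sub_zero] at hx
  change δ x ∈ _ at hx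
  rcases h with ⟨rfl, h⟩ | ⟨rfl, ht⟩
  · refine hker' x (h x ?_)
    rw [Set.image_singleton, Submodule.mem_span_singleton] at hx
    obtain ⟨c, hc⟩ := hx
    rw [← hc, derivation_smul hF]
    simp
  -- Polynomials in `t` have antiderivatives, so `x` differs from a polynomial in `t` by a constant.
  · have hanti : ∀ y ∈ Submodule.span F₁ ((fun j : ℕ => t ^ j) '' Set.univ),
        ∃ z ∈ Submodule.span F₁ ((fun j : ℕ => t ^ j) '' Set.univ), δ z = y := by
      intro y hy
      induction hy using Submodule.span_induction with
      | mem y hy =>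
        obtain ⟨j, -, rfl⟩ := hy
        refine ⟨((j + 1 : ℕ) : F₁)⁻¹ • t ^ (j + 1), Submodule.smul_mem _ _
          (Submodule.subset_span ⟨j + 1, trivial, rfl⟩), ?_⟩
        rw [derivation_smul hF, δ.leibniz_pow, ht]
        simp only [add_tsub_cancel_right, smul_eq_mul, mul_one]
        rw [← Nat.cast_smul_eq_nsmul F₁, smul_smul,
          inv_mul_cancel₀ (by exact_mod_cast Nat.succ_ne_zero j), one_smul]
      | zero => exact ⟨0, Submodule.zero_mem _, map_zero _⟩
      | add y y' _ _ hy hy' =>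
        obtain ⟨z, hz, rfl⟩ := hy
        obtain ⟨z', hz', rfl⟩ := hy'
        exact ⟨z + z', add_mem hz hz', map_add _ _ _⟩
      | smul a y _ hy =>
        obtain ⟨z, hz, rfl⟩ := hy
        exact ⟨a • z, Submodule.smul_mem _ _ hz, derivation_smul hF _ _⟩
    obtain ⟨z, hz, hzx⟩ := hanti _ hx
    have := hker' (x - z) (by rw [map_sub, hzx, sub_self])
    simpa using add_mem this hz

end DifferentialAlgebra

/-! ### Comparison with the model algebra. -/

section Structure

open Module

/-- The `F₁`-linear map from the ambient space of the model sending `u_{α,j}` to `u_α t ^ j`. -/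
def modelMap {F B : Type*} [Field F] [CommRing B] (F₁ : Type*) [Field F₁] [Algebra F₁ B]
    {Δ : AddSubgroup F} (u : Δ → Bˣ) (t : B) : Ambient Δ F₁ →ₗ[F₁] B :=
  Finsupp.linearCombination F₁ fun p : Δ × ℕ => (u p.1 : B) * t ^ p.2

theorem modelMap_single {F B : Type*} [Field F] [CommRing B] {F₁ : Type*} [Field F₁]
    [Algebra F₁ B] {Δ : AddSubgroup F} (u : Δ → Bˣ) (t : B) (p : Δ × ℕ) (c : F₁) :
    modelMap F₁ u t (Finsupp.single p c) = c • ((u p.1 : B) * t ^ p.2) := by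
  simp [modelMap]

theorem modelMap_dot {F B : Type*} [Field F] [CommRing B] {F₁ : Type*} [Field F₁]
    [Algebra F₁ B] {Δ : AddSubgroup F} (u : Δ → Bˣ) (t : B) {f : Δ → Δ → F₁ˣ}
    (hf : ∀ α β, (u α : B) * u β = (f α β : F₁) • (u (α + β) : B)) (x y : Ambient Δ F₁) :
    modelMap F₁ u t (dot f x y) = modelMap F₁ u t x * modelMap F₁ u t y := by
  have : (dot f).compr₂ (modelMap F₁ u t) =
      (LinearMap.mul F₁ B).compl₁₂ (modelMap F₁ u t) (modelMap F₁ u t) := by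
    ext p q
    simp only [dot, LinearMap.compr₂_apply, LinearMap.compl₁₂_apply, LinearMap.mul_apply',
      LinearMap.comp_apply, Finsupp.lsingle_apply, Finsupp.linearCombination_single, one_smul,
      modelMap_single, Prod.fst_add, Prod.snd_add]
    rw [← smul_mul_assoc, ← hf]
    ring
  exact LinearMap.congr_fun₂ this x y

variable {F B : Type*} [Field F] [CommRing B] [Algebra F B] {δ : Derivation F B B}
  {F₁ : Type*} [Field F₁] [Algebra F₁ B] {Δ : AddSubgroup F} {u : Δ → Bˣ} {t : B} {J : Set ℕ}

theorem modelMap_der [Algebra F F₁] [IsScalarTower F F₁ B]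
    (hF : ∀ c : F₁, δ (algebraMap F₁ B c) = 0)
    (hu : ∀ α : Δ, δ (u α) = (α : F) • (u α : B)) (ht : IsSlice δ J t) (x : Ambient Δ F₁)
    (hx : x ∈ A Δ F₁ J) : modelMap F₁ u t (der Δ F₁ x) = δ (modelMap F₁ u t x) := by
  rw [A, Finsupp.supported_eq_span_single] at hx
  induction hx using Submodule.span_induction with
  | zero => simp
  | add x y _ _ ihx ihy => simp only [map_add, ihx, ihy]
  | smul a x _ ih => rw [map_smul, map_smul, ih, map_smul, derivation_smul hF]
  | mem x hx =>
    obtain ⟨⟨α, j⟩, hj, rfl⟩ := hx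
    simp only [der, Finsupp.linearCombination_single, one_smul, map_add, modelMap_single,
      δ.leibniz, δ.leibniz_pow, hu, smul_eq_mul, nsmul_eq_mul]
    simp only [Algebra.smul_def, map_natCast, ← IsScalarTower.algebraMap_apply]
    rcases ht with ⟨rfl, _⟩ | ⟨rfl, ht⟩
    · obtain rfl : j = 0 := hj
      simp
    · rw [ht]
      ring

theorem modelMap_surjOn [IsAlgClosed F] [CharZero F₁]
    (hF : ∀ c : F₁, δ (algebraMap F₁ B c) = 0)
    (hker : ∀ a, δ a = 0 → ∃ c, algebraMap F₁ B c = a)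
    (hloc : IsLocallyFinite (δ : B →ₗ[F] B))
    (hu : ∀ α : Δ, δ (u α) = (α : F) • (u α : B)) (ht : IsSlice δ J t)
    (hΔ : ∀ α, weightSpace δ α ≠ ⊥ → α ∈ Δ) (b : B) :
    ∃ x ∈ A Δ F₁ J, modelMap F₁ u t x = b := by
  have hb : b ∈ ⨆ α, weightSpace δ α := by
    rw [iSup_maxGenEigenspace_eq_top_of_isLocallyFinite hloc]
    trivial
  induction hb using Submodule.iSup_induction' with
  | zero => exact ⟨0, zero_mem _, map_zero _⟩
  | add y z _ _ hy hz =>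
    obtain ⟨y', hy, rfl⟩ := hy
    obtain ⟨z', hz, rfl⟩ := hz
    exact ⟨y' + z', add_mem hy hz, map_add _ _ _⟩
  | mem α b hb =>
    by_cases hα : weightSpace δ α = ⊥
    · rw [hα] at hb
      obtain rfl : b = 0 := hb
      exact ⟨0, zero_mem _, map_zero _⟩
    obtain ⟨α, rfl⟩ : ∃ α' : Δ, (α' : F) = α := ⟨⟨α, hΔ α hα⟩, rfl⟩
    -- Dividing by the invertible eigenvector of weight `α` reduces to weight `0`.
    have h0 : (↑(u α)⁻¹ : B) * b ∈ weightSpace δ 0 := by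
      have := mul_mem_weightSpace δ
        (mem_maxGenEigenspace_of_eigen (derivation_eigen_inv δ (hu α))) hb
      simpa using this
    have h1 := ht.mem_span (F₁ := F₁) hF hker _ h0
    suffices h : ∀ z ∈ Submodule.span F₁ ((fun j : ℕ => t ^ j) '' J),
        ∃ x ∈ A Δ F₁ J, modelMap F₁ u t x = u α * z by
      simpa using h _ h1
    intro z hz
    induction hz using Submodule.span_induction with
    | mem z hz =>
      obtain ⟨j, hj, rfl⟩ := hz
      exact ⟨Finsupp.single (α, j) 1, Finsupp.single_mem_supported F₁ _ hj,
        by simp [modelMap_single]⟩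
    | zero => exact ⟨0, zero_mem _, by simp⟩
    | add y z _ _ hy hz =>
      obtain ⟨y', hy, hy'⟩ := hy
      obtain ⟨z', hz, hz'⟩ := hz
      exact ⟨y' + z', add_mem hy hz, by rw [map_add, hy', hz', mul_add]⟩
    | smul c y _ hy =>
      obtain ⟨y', hy, hy'⟩ := hy
      exact ⟨c • y', Submodule.smul_mem _ _ hy, by rw [map_smul, hy', mul_smul_comm]⟩

/-- Independence of the weight spaces separates the indices `α`; for fixed `α` the unit `u α`
cancels and the powers of `t` are independent. -/
theorem modelMap_injOn [Nontrivial B] [CharZero F₁]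
    (hF : ∀ c : F₁, δ (algebraMap F₁ B c) = 0)
    (hu : ∀ α : Δ, δ (u α) = (α : F) • (u α : B)) (ht : IsSlice δ J t)
    (x : Ambient Δ F₁) (hx : x ∈ A Δ F₁ J) (h0 : modelMap F₁ u t x = 0) : x = 0 := by
  have hcurry : ∀ α, x.curry α ∈ Finsupp.supported F₁ F₁ J := by
    intro α j hj
    refine hx (?_ : (α, j) ∈ _)
    simpa using hj
  set P : Δ → B := fun α => Finsupp.linearCombination F₁ (fun j : ℕ => t ^ j) (x.curry α) with hP
  have hP0 : ∀ α, P α ∈ weightSpace δ 0 := by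
    intro α
    rw [hP]
    simp only [Finsupp.linearCombination_apply]
    exact sum_mem fun j hj => smul_mem_weightSpace_zero hF _ (ht.pow_mem (hcurry α hj))
  have hsum : ∑ α ∈ x.curry.support, (u α : B) * P α = 0 := by
    rw [← h0, modelMap, Finsupp.linearCombination_apply,
      ← Finsupp.sum_curry_index x fun α j c => c • ((u α : B) * t ^ j)]
    refine Finset.sum_congr rfl fun α _ => ?_
    rw [hP]
    simp only [Finsupp.linearCombination_apply, Finsupp.sum, Finset.mul_sum, mul_smul_comm]
  have hind := (iSupIndep_iff_finsetSum_eq_zero_imp_eq_zero _).1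
    ((End.independent_maxGenEigenspace (δ : B →ₗ[F] B)).comp (Subtype.val_injective (p := (· ∈ Δ))))
    x.curry.support (fun α => (u α : B) * P α) (fun α _ => by
      simpa using mul_mem_weightSpace δ (mem_maxGenEigenspace_of_eigen (hu α)) (hP0 α)) hsum
  have hcurry0 : x.curry = 0 := by
    by_contra hne
    obtain ⟨α, hα⟩ := Finsupp.support_nonempty_iff.2 hne
    have h1 : P α = 0 := by simpa using hind α hα
    exact Finsupp.mem_support_iff.1 hα
      (linearIndepOn_iff.1 (ht.linearIndepOn hF) _ (hcurry α) h1)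
  ext ⟨α, j⟩
  rw [← Finsupp.curry_apply, hcurry0]
  rfl

variable [Algebra F F₁] [IsScalarTower F F₁ B]

/-- A commutative algebra with a locally finite derivation without proper stable ideals is
isomorphic, as a differential algebra, to one of the algebras `A(Δ, f, J)`. -/
theorem exists_model [IsAlgClosed F] [CharZero F] [Nontrivial B]
    (hs : IsDifferentiallySimple δ) (hloc : IsLocallyFinite (δ : B →ₗ[F] B))
    (hF : ∀ c : F₁, δ (algebraMap F₁ B c) = 0)
    (hker : ∀ a, δ a = 0 → ∃ c, algebraMap F₁ B c = a) :
    ∃ (Δ : AddSubgroup F) (f : Δ → Δ → F₁ˣ) (_ : IsSymmTwoCocycle f) (J : Set ℕ)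
      (hJ : J = {0} ∨ J = Set.univ) (Φ : A Δ F₁ J ≃ₗ[F] B),
      ∀ (ξ : F) (x y : A Δ F₁ J), Φ (circA f ξ hJ x y) = Φ x * (δ (Φ y) + ξ • Φ y) := by
  have : CharZero F₁ := charZero_of_injective_algebraMap (algebraMap F F₁).injective
  obtain ⟨J, t, ht⟩ := exists_isSlice hs
  have hJ : J = {0} ∨ J = Set.univ := ht.imp And.left And.left
  choose u hu using fun α : weightGroup δ => α.2
  -- The quotient `u_α u_β / u_{α+β}` has weight zero as an eigenvector, so it is a constant.
  have hf : ∀ α β, ∃ c : F₁ˣ, (u α : B) * u β = (c : F₁) • (u (α + β) : B) := by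
    intro α β
    have h1 : δ (↑(u α * u β * (u (α + β))⁻¹) : B) = 0 := by
      have := derivation_eigen_mul δ (derivation_eigen_mul δ (hu α) (hu β))
        (derivation_eigen_inv δ (hu (α + β)))
      simpa using this
    obtain ⟨c, hc⟩ := hker _ h1
    have hc0 : c ≠ 0 := by
      rintro rfl
      rw [map_zero] at hc
      exact (u α * u β * (u (α + β))⁻¹).ne_zero hc.symm
    refine ⟨Units.mk0 c hc0, ?_⟩
    rw [Units.val_mk0, Algebra.smul_def, hc]
    simp
  choose f hf using hf
  have hinj : ∀ (a b : F₁ˣ) (v : Bˣ), (a : F₁) • (v : B) = (b : F₁) • (v : B) → a = b := by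
    intro a b v h
    rw [Algebra.smul_def, Algebra.smul_def] at h
    exact Units.ext ((algebraMap F₁ B).injective (v.isUnit.mul_right_cancel h))
  have hcoc : IsSymmTwoCocycle f := by
    refine ⟨fun α β γ => hinj _ _ (u (α + β + γ)) ?_, fun α β => hinj _ _ (u (α + β)) ?_⟩
    · push_cast
      rw [mul_smul, ← hf, mul_comm (f α (β + γ) : F₁), mul_smul, add_assoc, ← hf,
        ← smul_mul_assoc, ← hf, ← mul_smul_comm, ← hf, mul_assoc]
    · rw [← hf, add_comm α β, ← hf, mul_comm]
  let Ψ : A (weightGroup δ) F₁ J →ₗ[F] B :=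
    ((modelMap F₁ u t).comp (A (weightGroup δ) F₁ J).subtype).restrictScalars F
  have hΨ : Function.Bijective Ψ := by
    refine ⟨fun x y hxy => ?_, fun b => ?_⟩
    · refine Subtype.ext (sub_eq_zero.1 (modelMap_injOn hF hu ht _ (sub_mem x.2 y.2) ?_))
      rw [map_sub, sub_eq_zero]
      exact hxy
    · obtain ⟨x, hx, hxb⟩ := modelMap_surjOn hF hker hloc hu ht (fun α => mem_weightGroup hs) b
      exact ⟨⟨x, hx⟩, hxb⟩
  refine ⟨weightGroup δ, f, hcoc, J, hJ, LinearEquiv.ofBijective Ψ hΨ, fun ξ x y => ?_⟩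
  change modelMap F₁ u t (circ f ξ x y) =
    modelMap F₁ u t x * (δ (modelMap F₁ u t y) + ξ • modelMap F₁ u t y)
  rw [circ, map_add, LinearMap.map_smul_of_tower, modelMap_dot u t hf, modelMap_dot u t hf,
    modelMap_der hF hu ht _ y.2, mul_add, mul_smul_comm]

end Structure

/-! ### The commutative algebra generated by the right multiplications. -/

section RightMultiplications

open Module

/-- A Novikov algebra `N` as a faithful module over a commutative algebra `C` of operators which
contains the right multiplications `R v` and is normalized by the left multiplications; `d u` is
the derivation of `C` induced by the left multiplication by `u`. -/
structure RightMulData (F N C : Type*) [Field F] [LeftPreLieRing N] [LeftPreLieAlgebra F N]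
    [CommRing C] [Algebra F C] [Module C N] where
  R : N →ₗ[F] C
  d : N →ₗ[F] Derivation F C C
  faithful : ∀ c : C, (∀ x : N, c • x = 0) → c = 0
  mul_eq : ∀ u w : N, u * w = R w • u
  mul_smul : ∀ (u : N) (c : C) (x : N), u * (c • x) = d u c • x + c • (u * x)

theorem left_symm {N : Type*} [LeftPreLieRing N] (u w x : N) :
    u * w * x - u * (w * x) = w * u * x - w * (u * x) :=
  LeftPreLieRing.assoc_symm u w x

open scoped IsMulCommutative in
-- The Novikov identity makes the generators commute, and left symmetry reads `[L_u, R_w] = R_{u w}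
-- - R_w R_u`, so commutation with `L_u` preserves the algebra they generate.
theorem exists_rightMulData (F : Type u) (N : Type v) [Field F] [LeftPreLieRing N]
    [LeftPreLieAlgebra F N] (hN : IsNovikov N) :
    ∃ (C : Type v) (_ : CommRing C) (_ : Algebra F C) (_ : Module C N) (_ : IsScalarTower F C N),
      Nonempty (RightMulData F N C) := by
  set s : Set (End F N) := Set.range fun w : N => LinearMap.mulRight F w with hs
  have hcomm : ∀ a ∈ s, ∀ b ∈ s, a * b = b * a := by
    rintro _ ⟨w, rfl⟩ _ ⟨x, rfl⟩
    ext u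
    exact hN u x w
  set S := Algebra.adjoin F s with hS
  have hgen : ∀ w : N, LinearMap.mulRight F w ∈ S := fun w => Algebra.subset_adjoin ⟨w, rfl⟩
  have had : ∀ (u : N), ∀ c ∈ S,
      LinearMap.mulLeft F u * c - c * LinearMap.mulLeft F u ∈ S := by
    intro u c hc
    induction hc using Algebra.adjoin_induction with
    | mem c hc =>
      obtain ⟨w, rfl⟩ := hc
      have : LinearMap.mulLeft F u * LinearMap.mulRight F w -
          LinearMap.mulRight F w * LinearMap.mulLeft F u =
          LinearMap.mulRight F (u * w) - LinearMap.mulRight F w * LinearMap.mulRight F u := by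
        ext x
        have := left_symm u x w
        simp only [LinearMap.sub_apply, Module.End.mul_apply, LinearMap.mulLeft_apply,
          LinearMap.mulRight_apply]
        rw [← sub_eq_zero] at this ⊢
        rw [← neg_eq_zero, ← this]
        abel
      rw [this]
      exact sub_mem (hgen _) (mul_mem (hgen _) (hgen _))
    | algebraMap r =>
      rw [Algebra.commutes, sub_self]
      exact zero_mem _
    | add a b _ _ ha hb =>
      convert add_mem ha hb using 1
      noncomm_ring
    | mul a b ha' hb' ha hb =>
      convert add_mem (mul_mem ha hb') (mul_mem ha' hb) using 1
      noncomm_ring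
  have _ : IsMulCommutative S := Algebra.isMulCommutative_adjoin F hcomm
  let R : N →ₗ[F] S :=
    { toFun := fun w => ⟨LinearMap.mulRight F w, hgen w⟩
      map_add' := fun w x => Subtype.ext (by ext; simp [mul_add])
      map_smul' := fun a w => Subtype.ext (by ext; simp [mul_smul_comm]) }
  let d₀ : N → S →ₗ[F] S := fun u =>
    { toFun := fun c => ⟨LinearMap.mulLeft F u * c - c * LinearMap.mulLeft F u, had u c c.2⟩
      map_add' := fun a b => Subtype.ext (by
        change _ * ((a : End F N) + b) - (a + b) * _ = (_ * a - a * _) + (_ * b - b * _)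
        noncomm_ring)
      map_smul' := fun r a => Subtype.ext (by
        change _ * (r • (a : End F N)) - (r • (a : End F N)) * _ = r • (_ * (a : End F N) - a * _)
        rw [mul_smul_comm, smul_mul_assoc, smul_sub]) }
  let d₁ : N → Derivation F S S := fun u => Derivation.mk' (d₀ u) (by
    intro a b
    refine Subtype.ext ?_
    have hab : (b : End F N) * (LinearMap.mulLeft F u * a - a * LinearMap.mulLeft F u) =
        (LinearMap.mulLeft F u * a - a * LinearMap.mulLeft F u) * b :=
      congrArg Subtype.val (mul_comm b (d₀ u a))
    change LinearMap.mulLeft F u * ((a : End F N) * b) - (a * b) * LinearMap.mulLeft F u =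
      (a : End F N) * (LinearMap.mulLeft F u * b - b * LinearMap.mulLeft F u) +
        b * (LinearMap.mulLeft F u * a - a * LinearMap.mulLeft F u)
    rw [hab]
    noncomm_ring)
  have hd : ∀ (u : N) (c : S) (x : N), ((d₁ u c : S) : End F N) x =
      u * (c : End F N) x - (c : End F N) (u * x) := fun u c x => rfl
  let d : N →ₗ[F] Derivation F S S :=
    { toFun := d₁
      map_add' := fun u w => Derivation.ext fun c => Subtype.ext (LinearMap.ext fun x => by
        change ((d₁ (u + w) c : S) : End F N) x =
          ((d₁ u c : S) : End F N) x + ((d₁ w c : S) : End F N) x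
        simp only [hd, add_mul, map_add]
        abel)
      map_smul' := fun r u => Derivation.ext fun c => Subtype.ext (LinearMap.ext fun x => by
        change ((d₁ (r • u) c : S) : End F N) x = r • ((d₁ u c : S) : End F N) x
        simp only [hd, smul_mul_assoc, map_smul, smul_sub]) }
  let _ : Module S N := Module.compHom N S.val.toRingHom
  refine ⟨S, inferInstance, inferInstance, inferInstance, ⟨fun r c x => rfl⟩, ⟨⟨R, d, ?_, ?_, ?_⟩⟩⟩
  · exact fun c hc => Subtype.ext (LinearMap.ext hc)
  · exact fun u w => rfl
  · intro u c x
    change u * (c : End F N) x = ((d₁ u c : S) : End F N) x + (c : End F N) (u * x)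
    rw [hd, sub_add_cancel]

namespace RightMulData

variable {F N C : Type*} [Field F] [LeftPreLieRing N] [LeftPreLieAlgebra F N]
    [CommRing C] [Algebra F C] [Module C N] (D : RightMulData F N C)

theorem R_mul (u w : N) : D.R (u * w) = D.d u (D.R w) + D.R w * D.R u := by
  rw [← sub_eq_zero]
  refine D.faithful _ fun x => ?_
  have h1 := D.mul_smul u (D.R w) x
  have h2 := left_symm u x w
  rw [← D.mul_eq, ← D.mul_eq] at h1
  rw [sub_smul, add_smul, SemigroupAction.mul_smul, ← D.mul_eq, ← D.mul_eq x u, ← D.mul_eq,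
    eq_sub_of_add_eq h1.symm, ← sub_eq_zero.2 h2]
  abel

variable [IsScalarTower F C N] {e : N} {b : F} (he : D.R e = algebraMap F C b)
include he

theorem mul_unit (u : N) : u * e = b • u := by
  rw [D.mul_eq, he, algebraMap_smul]

/-- Evaluation at `e` intertwines `d e + b` with the left multiplication by `e`. -/
theorem unit_mul_smul (c : C) : e * (c • e) = (D.d e c + b • c) • e := by
  rw [D.mul_smul, D.mul_unit he, add_smul, smul_assoc, smul_comm]

end RightMulData

end RightMultiplications

/-! ### The case in which evaluation at `e` is bijective. -/

section RankOne

open Module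

theorem isLocallyFinite_of_injective {F V W : Type*} [Field F] [AddCommGroup V] [Module F V]
    [AddCommGroup W] [Module F W] {T : V →ₗ[F] V} {S : W →ₗ[F] W} (g : V →ₗ[F] W)
    (hg : Function.Injective g) {β : F} (h : ∀ x, S (g x) = g (T x) + β • g x)
    (hS : IsLocallyFinite S) : IsLocallyFinite T := by
  intro v
  set P := Submodule.span F (Set.range fun m : ℕ => (S ^ m) (g v)) with hP
  have hfin : FiniteDimensional F P := hS (g v)
  have hstab : ∀ x ∈ P, S x ∈ P := by
    intro x hx
    induction hx using Submodule.span_induction with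
    | mem x hx =>
      obtain ⟨m, rfl⟩ := hx
      exact Submodule.subset_span ⟨m + 1, by simp [pow_succ']⟩
    | zero => simp
    | add x y _ _ hx hy => rw [map_add]; exact add_mem hx hy
    | smul a x _ hx => rw [map_smul]; exact Submodule.smul_mem _ _ hx
  have hmem : ∀ m : ℕ, g ((T ^ m) v) ∈ P := by
    intro m
    induction m with
    | zero => exact Submodule.subset_span ⟨0, by simp⟩
    | succ m ih =>
      rw [pow_succ', Module.End.mul_apply, ← add_sub_cancel_right (g (T _)), ← h]
      exact sub_mem (hstab _ ih) (Submodule.smul_mem _ _ ih)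
  have hle : Submodule.span F (Set.range fun m : ℕ => (T ^ m) v) ≤ P.comap g := by
    rw [Submodule.span_le]
    rintro _ ⟨m, rfl⟩
    exact hmem m
  have hfin' : FiniteDimensional F (P.comap g) :=
    FiniteDimensional.of_injective (g.restrict (p := P.comap g) (q := P) (fun x hx => hx))
      (fun x y hxy => Subtype.ext (hg (congrArg Subtype.val hxy)))
  exact Submodule.finiteDimensional_of_le hle

/-- The algebra `N` is isomorphic to one of the algebras `A(Δ, f, J)` with the operation `∘_ξ`. -/
def IsModelAlgebra (F : Type u) (N : Type v) [Field F] [LeftPreLieRing N]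
    [LeftPreLieAlgebra F N] : Prop :=
  ∃ (Δ : AddSubgroup F) (F₁ : Type v) (_ : Field F₁) (_ : Algebra F F₁)
    (f : Δ → Δ → F₁ˣ) (_ : IsSymmTwoCocycle f)
    (J : Set ℕ) (hJ : J = {0} ∨ J = Set.univ) (ξ : F)
    (φ : N ≃ₗ[F] A Δ F₁ J),
    ∀ u v : N, φ (u * v) = circA f ξ hJ (φ u) (φ v)

/-- The field of constants of a differentially simple algebra. -/
def constants {F B : Type*} [Field F] [CommRing B] [Algebra F B] (δ : Derivation F B B) :
    Subalgebra F B where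
  carrier := {c | δ c = 0}
  mul_mem' := by
    intro a b (ha : δ a = 0) (hb : δ b = 0)
    simp [ha, hb]
  add_mem' := by
    intro a b (ha : δ a = 0) (hb : δ b = 0)
    simp [ha, hb]
  algebraMap_mem' := by simp

theorem isField_constants {F B : Type*} [Field F] [CommRing B] [Algebra F B] [Nontrivial B]
    {δ : Derivation F B B} (hs : IsDifferentiallySimple δ) : IsField (constants δ) where
  exists_pair_ne := ⟨0, 1, zero_ne_one⟩
  mul_comm := mul_comm
  mul_inv_cancel := by
    rintro ⟨a, ha : δ a = 0⟩ ha0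
    obtain ⟨w, rfl⟩ := isUnit_of_eigen (α := 0) hs (by simpa using ha) fun h => ha0 (Subtype.ext h)
    refine ⟨⟨↑w⁻¹, ?_⟩, Subtype.ext w.mul_inv⟩
    have h := derivation_eigen_inv (α := 0) δ (u := w) (by simpa using ha)
    rwa [neg_zero, zero_smul] at h

namespace RightMulData

variable {F N C : Type*} [Field F] [LeftPreLieRing N] [LeftPreLieAlgebra F N]
    [CommRing C] [Algebra F C] [Module C N] (D : RightMulData F N C)

include D in
theorem nontrivial (hsimple : IsSimple F N) : Nontrivial C := by
  obtain ⟨u, w, h⟩ := hsimple.2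
  by_contra hC
  rw [not_nontrivial_iff_subsingleton] at hC
  rw [D.mul_eq, Subsingleton.elim (D.R w) 0, zero_smul] at h
  exact h rfl

variable [IsScalarTower F C N] {e : N} {b : F}

theorem R_smul (he : D.R e = algebraMap F C b) (hinj : ∀ c : C, c • e = 0 → c = 0) (c : C) :
    D.R (c • e) = D.d e c + b • c := by
  rw [← sub_eq_zero]
  refine hinj _ ?_
  rw [sub_smul, ← D.mul_eq, D.unit_mul_smul he, sub_self]

/-- Both sides come from computing `u * (c • e)`, once by the Leibniz rule and once as a right
multiplication. It is the main tool for trading `u` against `e`. -/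
theorem d_smul (he : D.R e = algebraMap F C b) (hinj : ∀ c : C, c • e = 0 → c = 0) (c : C)
    (u : N) : D.d u c • e = D.d e c • u := by
  have h := D.mul_smul u c e
  rw [D.mul_eq, D.R_smul he hinj, D.mul_unit he, add_smul, smul_comm c b u, smul_assoc] at h
  exact (add_right_cancel h).symm

theorem isLocallyFinite_d (he : D.R e = algebraMap F C b) (hinj : ∀ c : C, c • e = 0 → c = 0)
    (hloc : IsLocallyFinite (LinearMap.mulLeft F e)) :
    IsLocallyFinite (D.d e : C →ₗ[F] C) := by
  refine isLocallyFinite_of_injective (S := LinearMap.mulLeft F e) (β := b)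
    ((LinearMap.toSpanSingleton C N e).restrictScalars F) ?_ ?_ hloc
  · intro x y hxy
    exact sub_eq_zero.1 (hinj _ (by rw [sub_smul]; exact sub_eq_zero.2 hxy))
  · intro x
    change e * (x • e) = D.d e x • e + b • (x • e)
    rw [D.unit_mul_smul he, add_smul, smul_assoc]

/-- Since `(a • e) * (c • e) = a (d e c + b c) • e`, evaluation at `e` carries stable ideals of `C`
to two-sided ideals of `N`. -/
theorem isDifferentiallySimple (he : D.R e = algebraMap F C b)
    (hinj : ∀ c : C, c • e = 0 → c = 0) (hsurj : ∀ x : N, ∃ c : C, c • e = x)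
    (hsimple : IsSimple F N) : IsDifferentiallySimple (D.d e) := by
  intro I hI
  let P : Submodule F N :=
    (I.restrictScalars F).map ((LinearMap.toSpanSingleton C N e).restrictScalars F)
  have hP : ∀ x, x ∈ P ↔ ∃ c ∈ I, c • e = x := fun x => Iff.rfl
  have hideal : ∀ u : N, ∀ x ∈ P, u * x ∈ P ∧ x * u ∈ P := by
    rintro u _ ⟨c, hc, rfl⟩
    obtain ⟨a, rfl⟩ := hsurj u
    change a • e * c • e ∈ P ∧ c • e * a • e ∈ P
    rw [D.mul_eq, D.mul_eq, D.R_smul he hinj, ← SemigroupAction.mul_smul,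
      ← SemigroupAction.mul_smul]
    refine ⟨⟨_, ?_, rfl⟩, ⟨_, I.mul_mem_left _ hc, rfl⟩⟩
    refine I.mul_mem_right _ (add_mem (hI c hc) ?_)
    rw [Algebra.smul_def]
    exact I.mul_mem_left _ hc
  rcases hsimple.1 P hideal with h | h
  · left
    rw [Submodule.eq_bot_iff]
    intro c hc
    have : c • e ∈ P := ⟨c, hc, rfl⟩
    rw [h] at this
    exact hinj c this
  · right
    have : e ∈ P := h ▸ Submodule.mem_top
    obtain ⟨c, hc, hce⟩ := (hP e).1 this
    have : c - 1 = 0 := hinj _ (by rw [sub_smul, hce, one_smul, sub_self])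
    rw [sub_eq_zero] at this
    exact (Ideal.eq_top_iff_one I).2 (this ▸ hc)

end RightMulData

theorem RightMulData.isModelAlgebra {F : Type u} [Field F] [CharZero F] [IsAlgClosed F]
    {N C : Type v} [LeftPreLieRing N] [LeftPreLieAlgebra F N]
    [CommRing C] [Algebra F C] [Module C N] (D : RightMulData F N C)
    [IsScalarTower F C N] {e : N} {b : F} (he : D.R e = algebraMap F C b)
    (hinj : ∀ c : C, c • e = 0 → c = 0) (hsurj : ∀ x : N, ∃ c : C, c • e = x)
    (hsimple : IsSimple F N) (hloc : IsLocallyFinite (LinearMap.mulLeft F e)) :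
    IsModelAlgebra F N := by
  have := D.nontrivial hsimple
  have hs := D.isDifferentiallySimple he hinj hsurj hsimple
  let _ : Field (constants (D.d e)) := (isField_constants hs).toField
  obtain ⟨Δ, f, hf, J, hJ, Φ, hΦ⟩ := exists_model (F₁ := constants (D.d e)) hs
    (D.isLocallyFinite_d he hinj hloc) (fun c => c.2) (fun a ha => ⟨⟨a, ha⟩, rfl⟩)
  let κ : C ≃ₗ[F] N := LinearEquiv.ofBijective
    ((LinearMap.toSpanSingleton C N e).restrictScalars F)
    ⟨fun x y hxy => sub_eq_zero.1 (hinj _ (by rw [sub_smul]; exact sub_eq_zero.2 hxy)), hsurj⟩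
  have hκ : ∀ c, κ c = c • e := fun c => rfl
  refine ⟨Δ, constants (D.d e), inferInstance, inferInstance, f, hf, J, hJ, b,
    κ.symm.trans Φ.symm, fun u w => ?_⟩
  apply Φ.injective
  rw [hΦ]
  simp only [LinearEquiv.trans_apply, LinearEquiv.apply_symm_apply]
  obtain ⟨a, rfl⟩ := κ.surjective u
  obtain ⟨c, rfl⟩ := κ.surjective w
  rw [LinearEquiv.symm_apply_apply, LinearEquiv.symm_apply_apply, LinearEquiv.symm_apply_eq,
    hκ, hκ, hκ, D.mul_eq, D.R_smul he hinj, ← SemigroupAction.mul_smul, mul_comm]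

/-- The case in which the right multiplication by `e` vanishes. -/
theorem isModelAlgebra_of_mulRight_eq_zero {F : Type u} [Field F] [CharZero F] [IsAlgClosed F]
    {N : Type v} [LeftPreLieRing N] [LeftPreLieAlgebra F N] (hN : IsNovikov N)
    (hsimple : IsSimple F N) (e : N) (hloc : IsLocallyFinite (LinearMap.mulLeft F e))
    (h0 : ∀ x : N, x * e = 0) (hsurj : ∀ x : N, ∃ y, e * y = x) : IsModelAlgebra F N := by
  obtain ⟨C, _, _, _, _, ⟨D⟩⟩ := exists_rightMulData F N hN
  have hsurj' : ∀ x : N, ∃ w, D.R w • e = x := by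
    intro x
    obtain ⟨y, rfl⟩ := hsurj x
    exact ⟨y, (D.mul_eq _ _).symm⟩
  refine D.isModelAlgebra (e := e) (b := 0) ?_ ?_ ?_ hsimple hloc
  · rw [map_zero]
    exact D.faithful _ fun x => by rw [← D.mul_eq, h0]
  · intro c hc
    -- An operator killing `e` kills every `D.R w • e` by commutativity, and these exhaust `N`.
    refine D.faithful c fun x => ?_
    obtain ⟨w, rfl⟩ := hsurj' x
    rw [smul_comm, hc, smul_zero]
  · intro x
    obtain ⟨w, hw⟩ := hsurj' x
    exact ⟨_, hw⟩

end RankOne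

/-! ### The case `b ≠ 0`: differential ideals and injectivity of evaluation. -/

namespace RightMulData

open Module

variable {F N C : Type*} [Field F] [LeftPreLieRing N] [LeftPreLieAlgebra F N]
    [CommRing C] [Algebra F C] [Module C N] (D : RightMulData F N C)

/-- Ideals stable under the derivations induced by all left multiplications. -/
def IsDifferential (I : Ideal C) : Prop :=
  ∀ u : N, ∀ c ∈ I, D.d u c ∈ I

variable {D}

theorem IsDifferential.smul_eq_top {I : Ideal C} (hI : D.IsDifferential I) (h0 : I ≠ ⊥)
    [IsScalarTower F C N] (hsimple : IsSimple F N) : I • (⊤ : Submodule C N) = ⊤ := by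
  let P : Submodule F N := (I • (⊤ : Submodule C N)).restrictScalars F
  have hP : ∀ x, x ∈ P ↔ x ∈ I • (⊤ : Submodule C N) := fun x => Iff.rfl
  have hideal : ∀ u : N, ∀ x ∈ P, u * x ∈ P ∧ x * u ∈ P := by
    intro u x hx
    rw [hP] at hx
    rw [hP, hP]
    constructor
    · refine Submodule.smul_induction_on hx (fun c hc x _ => ?_) fun x y hx hy => ?_
      · rw [D.mul_smul]
        exact add_mem (Submodule.smul_mem_smul (hI u c hc) trivial)
          (Submodule.smul_mem_smul hc trivial)
      · rw [mul_add]
        exact add_mem hx hy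
    · rw [D.mul_eq]
      exact Submodule.smul_mem _ _ hx
  rcases hsimple.1 P hideal with h | h
  · refine absurd ((Submodule.eq_bot_iff I).2 fun c hc => D.faithful c fun x => ?_) h0
    have : c • x ∈ P := (hP _).2 (Submodule.smul_mem_smul hc trivial)
    rwa [h] at this
  · rw [eq_top_iff]
    intro x _
    exact (hP x).1 (h ▸ Submodule.mem_top)

variable [IsScalarTower F C N] {e : N} {b : F}

/-- By Leibniz `d x (c * a)` also kills `e`, so expanding `x * ((c * a) • e) = 0` leaves `b • (c *
a) • x = 0`. -/
theorem mul_eq_zero_of_smul_eq_zero (he : D.R e = algebraMap F C b) (hb : b ≠ 0) {c a : C}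
    (hc : c • e = 0) (ha : a • e = 0) : c * a = 0 := by
  refine D.faithful _ fun x => ?_
  have h := D.mul_smul x (c * a) e
  have h1 : D.d x (c * a) • e = 0 := by
    rw [Derivation.leibniz, smul_eq_mul, smul_eq_mul, add_smul, mul_comm c, mul_comm a,
      SemigroupAction.mul_smul, SemigroupAction.mul_smul, hc, ha, smul_zero, smul_zero, add_zero]
  rw [SemigroupAction.mul_smul, ha, smul_zero, mul_zero, h1, zero_add, D.mul_unit he,
    smul_comm] at h
  exact (smul_eq_zero_iff_right hb).1 h.symm

theorem IsDifferential.exists_smul_eq (he : D.R e = algebraMap F C b) (hb : b ≠ 0)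
    (hsimple : IsSimple F N) {I : Ideal C} (hI : D.IsDifferential I) (h0 : I ≠ ⊥)
    (hann : ∀ c : C, c • e = 0 → c ∈ I) : ∃ c ∈ I, c • e = e := by
  have hR : ∀ c ∈ I, D.R (c • e) ∈ I := by
    intro c hc
    have h1 : D.R (c • e) - (D.d e c + b • c) ∈ I := by
      refine hann _ ?_
      rw [sub_smul, ← D.mul_eq, D.unit_mul_smul he, sub_self]
    have h2 : D.d e c + b • c ∈ I := add_mem (hI e c hc) (Submodule.smul_of_tower_mem I b hc)
    simpa using add_mem h1 h2
  -- For `c ∈ I`, the Leibniz rule gives `b • c • x = x * (c • e) - d x c • e`. Multiplying by `e`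
  -- on the left turns both terms into elements of `I` applied to `e`.
  have key : ∀ x ∈ I • (⊤ : Submodule C N), ∃ c ∈ I, c • e = e * x := by
    intro x hx
    refine Submodule.smul_induction_on hx (fun c hc x _ => ?_) fun x y hx hy => ?_
    · refine ⟨b⁻¹ • (D.R (x * (c • e)) - (D.d e (D.d x c) + b • D.d x c)),
        Submodule.smul_of_tower_mem I _ (sub_mem ?_ (add_mem (hI e _ (hI x c hc))
          (Submodule.smul_of_tower_mem I b (hI x c hc)))), ?_⟩
      · rw [D.R_mul]
        exact add_mem (hI x _ (hR c hc)) (I.mul_mem_right _ (hR c hc))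
      · rw [smul_assoc, sub_smul, ← D.mul_eq, ← D.unit_mul_smul he, ← mul_sub, D.mul_smul,
          add_sub_cancel_left, D.mul_unit he, smul_comm c b x, mul_smul_comm, smul_smul,
          inv_mul_cancel₀ hb, one_smul]
    · obtain ⟨c, hc, hcx⟩ := hx
      obtain ⟨a, ha, hay⟩ := hy
      exact ⟨c + a, add_mem hc ha, by rw [add_smul, hcx, hay, mul_add]⟩
  -- As `I • N = N`, the case `x = e` is allowed, and `e * e = b • e`.
  obtain ⟨c, hc, hce⟩ := key e (by rw [hI.smul_eq_top h0 hsimple]; trivial)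
  refine ⟨b⁻¹ • c, Submodule.smul_of_tower_mem I _ hc, ?_⟩
  rw [smul_assoc, hce, D.mul_unit he, smul_smul, inv_mul_cancel₀ hb, one_smul]

theorem unit_ne_zero (he : D.R e = algebraMap F C b) (hb : b ≠ 0) (hsimple : IsSimple F N) :
    e ≠ 0 := by
  rintro rfl
  obtain ⟨u, w, h⟩ := hsimple.2
  have hu := D.mul_unit he u
  rw [mul_zero] at hu
  rw [(smul_eq_zero_iff_right hb).1 hu.symm, zero_mul] at h
  exact h rfl

/-- Evaluation of right multiplication operators at `e` is injective. -/
theorem eq_zero_of_smul_unit_eq_zero [CharZero F] (he : D.R e = algebraMap F C b) (hb : b ≠ 0)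
    (hsimple : IsSimple F N) (c : C) (hc : c • e = 0) : c = 0 := by
  have hann : ∀ c : C, c • e = 0 → c ∈ nilradical C := fun c hc =>
    ⟨2, by rw [pow_two]; exact D.mul_eq_zero_of_smul_eq_zero he hb hc hc⟩
  by_cases h0 : nilradical C = ⊥
  · have := hann c hc
    rwa [h0] at this
  · have hI : D.IsDifferential (nilradical C) := fun u c hc => isNilpotent_derivation _ hc
    obtain ⟨a, ⟨n, hn⟩, hae⟩ := hI.exists_smul_eq he hb hsimple h0 hann
    have hpow : ∀ k : ℕ, a ^ k • e = e := by
      intro k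
      induction k with
      | zero => simp
      | succ k ih => rw [pow_succ, SemigroupAction.mul_smul, hae, ih]
    refine absurd (hpow n).symm ?_
    rw [hn, zero_smul]
    exact unit_ne_zero he hb hsimple

theorem IsDifferential.eq_bot_or_top [CharZero F] (he : D.R e = algebraMap F C b) (hb : b ≠ 0)
    (hsimple : IsSimple F N) {I : Ideal C} (hI : D.IsDifferential I) : I = ⊥ ∨ I = ⊤ := by
  refine or_iff_not_imp_left.2 fun h0 => ?_
  have hinj := D.eq_zero_of_smul_unit_eq_zero he hb hsimple
  obtain ⟨c, hc, hce⟩ := hI.exists_smul_eq he hb hsimple h0 fun c hc => by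
    rw [hinj c hc]
    exact zero_mem _
  have : c - 1 = 0 := hinj _ (by rw [sub_smul, hce, one_smul, sub_self])
  rw [sub_eq_zero] at this
  exact (Ideal.eq_top_iff_one I).2 (this ▸ hc)

end RightMulData

/-! ### Weights of the left multiplication by `e` and of `d e`. -/

namespace RightMulData

open Module

variable {F N C : Type*} [Field F] [LeftPreLieRing N] [LeftPreLieAlgebra F N]
    [CommRing C] [Algebra F C] [Module C N] {D : RightMulData F N C} {e : N} {b : F}

theorem exists_smul_unit_of_mem (D : RightMulData F N C) {e : N} {α : F} (hα : α ≠ 0) {x : N}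
    (hx : x ∈ End.maxGenEigenspace (LinearMap.mulLeft F e) α) : ∃ c : C, c • e = x := by
  obtain ⟨w, -, rfl⟩ := exists_preimage_of_mem_maxGenEigenspace hα x hx
  exact ⟨D.R w, (D.mul_eq _ _).symm⟩

theorem R_mem_weightSpace (he : D.R e = algebraMap F C b) {α : F} {w : N}
    (hw : w ∈ End.maxGenEigenspace (LinearMap.mulLeft F e) α) :
    D.R w ∈ weightSpace (D.d e) (α + -b) := by
  refine map_mem_maxGenEigenspace (S := (D.d e : C →ₗ[F] C)) D.R (fun w => ?_) α w hw
  change D.d e (D.R w) = D.R (e * w) + -b • D.R w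
  rw [D.R_mul, he, Algebra.smul_def, map_neg]
  ring

variable [IsScalarTower F C N]

section Injective

variable (he : D.R e = algebraMap F C b) (hinj : ∀ c : C, c • e = 0 → c = 0)
include he hinj

/-- Obtained by multiplying the identity `d u c • e = d e c • u` by `e` on the left. -/
theorem d_d {u : N} (c : C) :
    D.d e (D.d u c) = D.d u (D.d e c) + D.d (e * u) c - b • D.d u c := by
  rw [← sub_eq_zero]
  refine hinj _ ?_
  have h1 := D.unit_mul_smul he (D.d u c)
  rw [D.d_smul he hinj, D.mul_smul, ← D.d_smul he hinj, ← D.d_smul he hinj, ← add_smul,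
    ← sub_eq_zero, ← sub_smul] at h1
  rw [← neg_eq_zero, ← neg_smul, ← h1]
  congr 1
  ring

theorem d_mem_weightSpace {α : F} {u : N}
    (hu : u ∈ End.maxGenEigenspace (LinearMap.mulLeft F e) 0) {c : C}
    (hc : c ∈ weightSpace (D.d e) α) : D.d u c ∈ weightSpace (D.d e) (α - b) := by
  revert u c
  suffices h : ∀ u ∈ End.maxGenEigenspace (LinearMap.mulLeft F e) 0,
      ∀ c ∈ weightSpace (D.d e) α, D.d u c ∈ weightSpace (D.d e) (α - b) by
    intro u hu c hc
    exact h u hu c hc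
  refine maxGenEigenspace_induction (fun c _ => by simp) fun u _ ihu => ?_
  refine maxGenEigenspace_induction (by simp) fun c hc ihc => ?_
  refine mem_maxGenEigenspace_of_sub_mem ?_
  have h1 := ihu c hc
  rw [zero_smul, sub_zero] at h1
  convert add_mem h1 ihc using 1
  change D.d e (D.d u c) - _ = D.d (e * u) c + D.d u (D.d e c - α • c)
  rw [D.d_d he hinj, map_sub, Derivation.map_smul]
  module

theorem d_eq_zero_of_d_unit_eq_zero {a : C} (ha : D.d e a = 0) (u : N) : D.d u a = 0 :=
  hinj _ (by rw [D.d_smul he hinj, ha, zero_smul])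

theorem d_smul_unit (a c : C) : D.d (a • e) c = a * D.d e c := by
  rw [← sub_eq_zero]
  refine hinj _ ?_
  rw [sub_smul, D.d_smul he hinj, SemigroupAction.mul_smul, smul_comm, sub_self]

/-- On a nonzero weight `d e` is invertible; writing `c = d e a`, the factor `u` can be traded for
`e`. Thus nonzero weights map `N` into `C • e`. -/
theorem exists_smul_unit_eq_smul {α : F} (hα : α ≠ 0) {c : C} (hc : c ∈ weightSpace (D.d e) α)
    (u : N) : ∃ a ∈ weightSpace (D.d e) α, c • u = D.d u a • e := by
  obtain ⟨a, ha, rfl⟩ := exists_preimage_of_mem_maxGenEigenspace hα c hc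
  exact ⟨a, ha, (D.d_smul he hinj a u).symm⟩

/-- To check that an ideal is differential it suffices to consider generators, and derivations
coming from `e` and from the generalized kernel of the left multiplication by `e`. -/
theorem isDifferential_span
    (htop : ⨆ α, End.maxGenEigenspace (LinearMap.mulLeft F e) α = ⊤) {s : Set C}
    (h1 : ∀ c ∈ s, D.d e c ∈ Ideal.span s)
    (h2 : ∀ u ∈ End.maxGenEigenspace (LinearMap.mulLeft F e) 0, ∀ c ∈ s,
      D.d u c ∈ Ideal.span s) : D.IsDifferential (Ideal.span s) := by
  intro u c hc
  have hu : u ∈ ⨆ α, End.maxGenEigenspace (LinearMap.mulLeft F e) α := htop ▸ Submodule.mem_top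
  induction hc using Submodule.span_induction with
  | zero => simp
  | add x y _ _ hx hy => rw [map_add]; exact add_mem hx hy
  | smul a x hx ih =>
    rw [smul_eq_mul, Derivation.leibniz]
    exact add_mem (Ideal.mul_mem_left _ _ ih) (Ideal.mul_mem_right _ _ hx)
  | mem c hc =>
    induction hu using Submodule.iSup_induction' with
    | zero => simp
    | add x y _ _ hx hy =>
      rw [map_add]
      exact add_mem hx hy
    | mem α u hu =>
      by_cases hα : α = 0
      · exact h2 u (hα ▸ hu) c hc
      · obtain ⟨a, rfl⟩ := D.exists_smul_unit_of_mem hα hu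
        rw [D.d_smul_unit he hinj]
        exact Ideal.mul_mem_left _ _ (h1 c hc)

end Injective

end RightMulData

/-! ### The case in which evaluation at `e` is not surjective. -/

namespace RightMulData

open Module

section NonCyclic

variable {F N C : Type*} [Field F] [LeftPreLieRing N] [LeftPreLieAlgebra F N]
    [CommRing C] [Algebra F C] [Module C N] {D : RightMulData F N C}
    {e : N} {b : F} (he : D.R e = algebraMap F C b) (hb : b ≠ 0)
    (hinj : ∀ c : C, c • e = 0 → c = 0)
    (hds : ∀ I : Ideal C, D.IsDifferential I → I = ⊥ ∨ I = ⊤)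
    (hN : ⨆ α, End.maxGenEigenspace (LinearMap.mulLeft F e) α = ⊤)
    (hC : ⨆ α, weightSpace (D.d e) α = ⊤)
    (hne : ¬ ∀ x : N, ∃ c : C, c • e = x)

include D hN hne in
theorem exists_ne_zero_mem_maxGenEigenspace_zero :
    ∃ u ∈ End.maxGenEigenspace (LinearMap.mulLeft F e) 0, u ≠ 0 := by
  by_contra! h
  refine hne fun x => ?_
  have hx : x ∈ ⨆ α, End.maxGenEigenspace (LinearMap.mulLeft F e) α := hN ▸ Submodule.mem_top
  induction hx using Submodule.iSup_induction' with
  | zero => exact ⟨0, zero_smul _ _⟩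
  | add x y _ _ hx hy =>
    obtain ⟨a, rfl⟩ := hx
    obtain ⟨c, rfl⟩ := hy
    exact ⟨a + c, add_smul _ _ _⟩
  | mem α x hx =>
    by_cases hα : α = 0
    · exact ⟨0, by rw [h x (hα ▸ hx), zero_smul]⟩
    · exact D.exists_smul_unit_of_mem hα hx

variable [IsScalarTower F C N]

include he hinj hds in
theorem isUnit_of_d_unit_eq_zero {a : C} (ha : D.d e a = 0) (h0 : a ≠ 0) : IsUnit a := by
  have hI : D.IsDifferential (Ideal.span {a}) := by
    intro u c hc
    obtain ⟨c, rfl⟩ := Ideal.mem_span_singleton.1 hc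
    rw [Derivation.leibniz, D.d_eq_zero_of_d_unit_eq_zero he hinj ha, smul_zero, add_zero]
    exact Ideal.mem_span_singleton.2 ⟨_, rfl⟩
  rcases hds _ hI with h | h
  · exact absurd (Ideal.span_singleton_eq_bot.1 h) h0
  · exact Ideal.span_singleton_eq_top.1 h

include he hinj hds hN hne in
-- The weights outside `ℕ b` generate a differential ideal, since lowering by `b` never enters `ℕ b`
-- from outside. This ideal maps `N` into `C • e`, so it cannot contain `1`.
theorem eq_zero_of_mem_weightSpace {α : F} (hα : ∀ n : ℕ, α ≠ n * b) {c : C}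
    (hc : c ∈ weightSpace (D.d e) α) : c = 0 := by
  set s : Set C := {c | ∃ α : F, (∀ n : ℕ, α ≠ n * b) ∧ c ∈ weightSpace (D.d e) α} with hs
  have hI : D.IsDifferential (Ideal.span s) := by
    refine isDifferential_span he hinj hN ?_ ?_
    · rintro c ⟨β, hβ, hc⟩
      exact Ideal.subset_span ⟨β, hβ, apply_mem_maxGenEigenspace hc⟩
    · rintro u hu c ⟨β, hβ, hc⟩
      refine Ideal.subset_span ⟨β - b, fun n h => hβ (n + 1) ?_, d_mem_weightSpace he hinj hu hc⟩
      rw [eq_add_of_sub_eq h]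
      push_cast
      ring
  have hcond : ∀ c ∈ Ideal.span s, ∀ x : N, ∃ a : C, a • e = c • x := by
    intro c hc x
    induction hc using Submodule.span_induction with
    | mem c hc =>
      obtain ⟨β, hβ, hc⟩ := hc
      obtain ⟨a, -, ha⟩ := exists_smul_unit_eq_smul he hinj (by simpa using hβ 0) hc x
      exact ⟨_, ha.symm⟩
    | zero => exact ⟨0, by simp⟩
    | add c c' _ _ h h' =>
      obtain ⟨a, ha⟩ := h
      obtain ⟨a', ha'⟩ := h'
      exact ⟨a + a', by rw [add_smul, add_smul, ha, ha']⟩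
    | smul r c _ h =>
      obtain ⟨a, ha⟩ := h
      exact ⟨r * a, by rw [SemigroupAction.mul_smul, ha, smul_assoc]⟩
  rcases hds _ hI with h | h
  · have : c ∈ Ideal.span s := Ideal.subset_span ⟨α, hα, hc⟩
    rwa [h] at this
  · refine absurd (fun x => ?_) hne
    simpa using hcond 1 (h ▸ Submodule.mem_top) x

variable [CharZero F]

include he hinj hds hN hne hb

theorem eq_zero_of_mem_weightSpace_neg {c : C} (hc : c ∈ weightSpace (D.d e) (-b)) : c = 0 := by
  refine eq_zero_of_mem_weightSpace he hinj hds hN hne (fun n h => ?_) hc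
  have h1 : ((n + 1 : ℕ) : F) * b = 0 := by
    push_cast
    linear_combination -h
  rcases mul_eq_zero.1 h1 with h2 | h2
  · exact Nat.cast_ne_zero.2 (Nat.succ_ne_zero n) h2
  · exact hb h2

theorem R_eq_zero {u : N} (hu : u ∈ End.maxGenEigenspace (LinearMap.mulLeft F e) 0) :
    D.R u = 0 := by
  refine eq_zero_of_mem_weightSpace_neg he hb hinj hds hN hne ?_
  simpa using R_mem_weightSpace he hu

theorem mem_maxGenEigenspace_zero_iff {u : N} :
    u ∈ End.maxGenEigenspace (LinearMap.mulLeft F e) 0 ↔ e * u = 0 := by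
  refine ⟨fun hu => ?_, fun hu => mem_maxGenEigenspace_of_eigen (by simpa using hu)⟩
  rw [D.mul_eq, R_eq_zero he hb hinj hds hN hne hu, zero_smul]

theorem d_eq_zero {u : N} (hu : u ∈ End.maxGenEigenspace (LinearMap.mulLeft F e) 0) {c : C}
    (hc : c ∈ weightSpace (D.d e) 0) : D.d u c = 0 := by
  refine eq_zero_of_mem_weightSpace_neg he hb hinj hds hN hne ?_
  simpa using d_mem_weightSpace he hinj hu hc

theorem d_unit_eq_zero {c : C} (hc : c ∈ weightSpace (D.d e) 0) : D.d e c = 0 := by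
  obtain ⟨u, hu, hu0⟩ := exists_ne_zero_mem_maxGenEigenspace_zero (D := D) hN hne
  -- A nonzero constant `d e c` would be a unit, yet it kills `u`, because `d e c • u = d u c • e =
  -- 0`.
  have key : ∀ c ∈ weightSpace (D.d e) 0, D.d e (D.d e c) = 0 → D.d e c = 0 := by
    intro c hc h
    by_contra h0
    have h1 : D.d e c • u = 0 := by
      rw [← D.d_smul he hinj, d_eq_zero he hb hinj hds hN hne hu hc, zero_smul]
    exact hu0 (((isUnit_of_d_unit_eq_zero he hinj hds h h0).smul_eq_zero).1 h1)
  refine maxGenEigenspace_induction (p := fun c => D.d e c = 0) (map_zero _)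
    (fun c hc h => key c hc ?_) c hc
  simpa using h

theorem smul_mem_maxGenEigenspace_zero {u : N}
    (hu : u ∈ End.maxGenEigenspace (LinearMap.mulLeft F e) 0) {c : C}
    (hc : c ∈ weightSpace (D.d e) 0) :
    c • u ∈ End.maxGenEigenspace (LinearMap.mulLeft F e) 0 := by
  rw [mem_maxGenEigenspace_zero_iff he hb hinj hds hN hne] at hu ⊢
  rw [D.mul_smul, hu, d_unit_eq_zero he hb hinj hds hN hne hc, zero_smul, smul_zero, add_zero]

include hC

/-- Otherwise the positive weights generate a differential ideal. If it is zero, `C` has weight zero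
only and the kernel of the left multiplication by `e` is a proper nonzero ideal of `N`; if it is
everything, `1` is a sum of elements of nonzero weight. -/
theorem exists_d_ne_zero (hsimple : IsSimple F N) :
    ∃ u ∈ End.maxGenEigenspace (LinearMap.mulLeft F e) 0, ∃ t ∈ weightSpace (D.d e) b,
      D.d u t ≠ 0 := by
  have _ := D.nontrivial hsimple
  by_contra! hcon
  obtain ⟨u, hu, hu0⟩ := exists_ne_zero_mem_maxGenEigenspace_zero (D := D) hN hne
  set s : Set C := {c | ∃ n : ℕ, c ∈ weightSpace (D.d e) ((n + 1 : ℕ) * b)} with hs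
  have hpos : ∀ n : ℕ, ((n + 1 : ℕ) : F) * b ≠ 0 := fun n =>
    mul_ne_zero (Nat.cast_ne_zero.2 (Nat.succ_ne_zero n)) hb
  have hI : D.IsDifferential (Ideal.span s) := by
    refine isDifferential_span he hinj hN ?_ ?_
    · rintro c ⟨n, hc⟩
      exact Ideal.subset_span ⟨n, apply_mem_maxGenEigenspace hc⟩
    · rintro u hu c ⟨n, hc⟩
      rcases n with _ | n
      · rw [hcon u hu c (by simpa using hc)]
        exact zero_mem _
      · refine Ideal.subset_span ⟨n, ?_⟩
        convert d_mem_weightSpace he hinj hu hc using 2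
        push_cast
        ring
  rcases hds _ hI with h | h
  · have hC0 : ∀ c : C, c ∈ weightSpace (D.d e) 0 := by
      intro c
      have hc : c ∈ ⨆ α, weightSpace (D.d e) α := hC ▸ Submodule.mem_top
      refine (iSup_le fun α c hc => ?_ : ⨆ α, weightSpace (D.d e) α ≤ weightSpace (D.d e) 0) hc
      by_cases hα : ∃ n : ℕ, α = n * b
      · obtain ⟨n, rfl⟩ := hα
        rcases n with _ | n
        · simpa using hc
        · have : c ∈ Ideal.span s := Ideal.subset_span ⟨n, hc⟩
          rw [h] at this
          rw [(Submodule.mem_bot C).1 this]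
          exact zero_mem _
      · push Not at hα
        rw [eq_zero_of_mem_weightSpace he hinj hds hN hne hα hc]
        exact zero_mem _
    have hideal : ∀ v : N, ∀ w ∈ End.maxGenEigenspace (LinearMap.mulLeft F e) 0,
        v * w ∈ End.maxGenEigenspace (LinearMap.mulLeft F e) 0 ∧
        w * v ∈ End.maxGenEigenspace (LinearMap.mulLeft F e) 0 := by
      intro v w hw
      rw [D.mul_eq, D.mul_eq, R_eq_zero he hb hinj hds hN hne hw, zero_smul]
      exact ⟨zero_mem _, smul_mem_maxGenEigenspace_zero he hb hinj hds hN hne hw (hC0 _)⟩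
    rcases hsimple.1 _ hideal with h | h
    · rw [h] at hu
      exact hu0 hu
    · have h1 : e ∈ End.maxGenEigenspace (LinearMap.mulLeft F e) 0 := h ▸ Submodule.mem_top
      rw [mem_maxGenEigenspace_zero_iff he hb hinj hds hN hne, D.mul_unit he,
        smul_eq_zero_iff_right hb] at h1
      exact unit_ne_zero he hb hsimple h1
  · set P := ⨆ α, ⨆ (_ : α ≠ 0), weightSpace (D.d e) α with hP
    have hmem : ∀ c ∈ s, ∀ a : C, a * c ∈ P := by
      rintro c ⟨n, hc⟩ a
      have ha : a ∈ ⨆ α, weightSpace (D.d e) α := hC ▸ Submodule.mem_top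
      induction ha using Submodule.iSup_induction' with
      | zero => simp
      | add x y _ _ hx hy => rw [add_mul]; exact add_mem hx hy
      | mem α a ha =>
        by_cases hα : ∃ m : ℕ, α = m * b
        · obtain ⟨m, rfl⟩ := hα
          have h1 := mul_mem_weightSpace (D.d e) ha hc
          rw [show (m : F) * b + (n + 1 : ℕ) * b = ((m + n + 1 : ℕ) : F) * b by
            push_cast; ring] at h1
          exact Submodule.mem_iSup_of_mem _ (Submodule.mem_iSup_of_mem (hpos (m + n)) h1)
        · push Not at hα
          rw [eq_zero_of_mem_weightSpace he hinj hds hN hne hα ha, zero_mul]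
          exact zero_mem _
    have hIP : ∀ c ∈ Ideal.span s, ∀ a : C, a * c ∈ P := by
      intro c hc
      induction hc using Submodule.span_induction with
      | mem c hc => exact hmem c hc
      | zero => intro a; simp
      | add x y _ _ hx hy => intro a; rw [mul_add]; exact add_mem (hx a) (hy a)
      | smul r x _ hx => intro a; rw [smul_eq_mul, ← mul_assoc]; exact hx _
    have h1 : (1 : C) ∈ P := by simpa using hIP 1 (h ▸ Submodule.mem_top) 1
    have hdis := End.independent_maxGenEigenspace (D.d e : C →ₗ[F] C) 0
    exact one_ne_zero (Submodule.disjoint_def.1 hdis 1 (one_mem_weightSpace _) h1)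

/-- If the right multiplication operators do not act transitively on `e`, then `N` contains an
element with vanishing right multiplication and surjective, locally nilpotent left
multiplication. -/
theorem exists_mulRight_eq_zero (hsimple : IsSimple F N) :
    ∃ u : N, D.R u = 0 ∧ (∀ x, ∃ y, u * y = x) ∧
      End.maxGenEigenspace (LinearMap.mulLeft F u) 0 = ⊤ := by
  obtain ⟨v, hv, t, ht, hvt⟩ := exists_d_ne_zero he hb hinj hds hN hC hne hsimple
  have hva : D.d v t ∈ weightSpace (D.d e) 0 := by simpa using d_mem_weightSpace he hinj hv ht
  have hva0 := d_unit_eq_zero he hb hinj hds hN hne hva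
  obtain ⟨w, hw⟩ := isUnit_of_d_unit_eq_zero he hinj hds hva0 hvt
  have hw0 : (↑w⁻¹ : C) ∈ weightSpace (D.d e) 0 := by
    refine mem_maxGenEigenspace_of_eigen (α := 0) ?_
    have := derivation_eigen_inv (D.d e) (u := w) (α := 0) (by simp [hw, hva0])
    simpa using this
  -- Rescaling by the unit `d v t` gives `d u t = 1`, hence `s • u = e` for `s = d e t`.
  set u : N := (↑w⁻¹ : C) • v with hu
  have huU := smul_mem_maxGenEigenspace_zero he hb hinj hds hN hne hv hw0
  rw [← hu] at huU
  have hRu := R_eq_zero he hb hinj hds hN hne huU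
  set s : C := D.d e t with hs
  have hsC : s ∈ weightSpace (D.d e) b := apply_mem_maxGenEigenspace ht
  have hsu : s • u = e := by
    rw [hu, smul_comm, hs, ← D.d_smul he hinj, ← hw, ← SemigroupAction.mul_smul, w.inv_mul,
      one_smul]
  have huu : ∀ m : N, m * u = 0 := fun m => by rw [D.mul_eq, hRu, zero_smul]
  have hbm : ∀ m : N, b • m = D.d m s • u := by
    intro m
    rw [← D.mul_unit he, ← hsu, D.mul_smul, huu, smul_zero, add_zero]
  have hus : D.d u s = algebraMap F C b := by
    rw [← sub_eq_zero]
    refine hinj _ ?_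
    rw [← hsu, smul_comm, sub_smul, ← hbm, algebraMap_smul, sub_self, smul_zero]
  have hupow : ∀ (c : C), c ∈ weightSpace (D.d e) 0 → ∀ n : ℕ,
      u * (c • s ^ (n + 1) • u) = (((n + 1 : ℕ) : F) * b) • (c • s ^ n • u) := by
    intro c hc n
    rw [D.mul_smul, d_eq_zero he hb hinj hds hN hne huU hc, zero_smul, zero_add, D.mul_smul, huu,
      smul_zero, add_zero, Derivation.leibniz_pow, hus,
      ← algebraMap_smul C (((n + 1 : ℕ) : F) * b), map_mul, map_natCast]
    simp only [smul_eq_mul, nsmul_eq_mul, add_tsub_cancel_right, ← SemigroupAction.mul_smul]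
    congr 1
    ring
  -- On these vectors the left multiplication by `u` acts as `b` times differentiation in `s`, so
  -- once they span `N` it is surjective and locally nilpotent.
  set V : Submodule F N := Submodule.span F
    {x | ∃ c ∈ weightSpace (D.d e) 0, ∃ n : ℕ, x = c • s ^ n • u} with hV
  have hUV : ∀ m ∈ End.maxGenEigenspace (LinearMap.mulLeft F e) 0, m ∈ V := by
    intro m hm
    refine Submodule.subset_span ⟨b⁻¹ • D.d m s, Submodule.smul_mem _ _ ?_, 0, ?_⟩
    · simpa using d_mem_weightSpace he hinj hm hsC
    · rw [pow_zero, one_smul, smul_assoc, ← hbm, smul_smul, inv_mul_cancel₀ hb, one_smul]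
  have hsV : ∀ x ∈ V, s • x ∈ V := by
    intro x hx
    induction hx using Submodule.span_induction with
    | mem x hx =>
      obtain ⟨c, hc, n, rfl⟩ := hx
      refine Submodule.subset_span ⟨c, hc, n + 1, ?_⟩
      rw [smul_comm, ← SemigroupAction.mul_smul s, pow_succ']
    | zero => simp
    | add x y _ _ hx hy => rw [smul_add]; exact add_mem hx hy
    | smul a x _ hx => rw [smul_comm]; exact Submodule.smul_mem _ _ hx
  have hCV : ∀ n : ℕ, ∀ c ∈ weightSpace (D.d e) (n * b), c • e ∈ V := by
    intro n
    induction n with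
    | zero =>
      intro c hc
      rw [← hsu, smul_comm]
      refine hsV _ (hUV _ (smul_mem_maxGenEigenspace_zero he hb hinj hds hN hne huU ?_))
      simpa using hc
    | succ n ih =>
      intro c hc
      -- Here `c • e = s • (c • u) = s • (d u a • e)`, and `d u a` has weight `n * b`.
      obtain ⟨a, ha, hca⟩ := exists_smul_unit_eq_smul he hinj
        (mul_ne_zero (Nat.cast_ne_zero.2 (Nat.succ_ne_zero n)) hb) hc u
      rw [← hsu, smul_comm, hca]
      refine hsV _ (ih _ ?_)
      convert d_mem_weightSpace he hinj huU ha using 2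
      push_cast
      ring
  have hCV' : ∀ c : C, c • e ∈ V := by
    intro c
    have hc : c ∈ ⨆ α, weightSpace (D.d e) α := hC ▸ Submodule.mem_top
    induction hc using Submodule.iSup_induction' with
    | zero => simp
    | add x y _ _ hx hy => rw [add_smul]; exact add_mem hx hy
    | mem α c hc =>
      by_cases hα : ∃ n : ℕ, α = n * b
      · obtain ⟨n, rfl⟩ := hα
        exact hCV n c hc
      · push Not at hα
        rw [eq_zero_of_mem_weightSpace he hinj hds hN hne hα hc, zero_smul]
        exact zero_mem _
  have hVtop : V = ⊤ := by
    rw [eq_top_iff, ← hN]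
    refine iSup_le fun α x hx => ?_
    by_cases hα : α = 0
    · exact hUV x (hα ▸ hx)
    · obtain ⟨c, rfl⟩ := D.exists_smul_unit_of_mem hα hx
      exact hCV' c
  refine ⟨u, hRu, fun x => ?_, ?_⟩
  · have hle : V ≤ LinearMap.range (LinearMap.mulLeft F u) := by
      rw [hV, Submodule.span_le]
      rintro _ ⟨c, hc, n, rfl⟩
      refine ⟨(((n + 1 : ℕ) : F) * b)⁻¹ • (c • s ^ (n + 1) • u), ?_⟩
      rw [map_smul, LinearMap.mulLeft_apply, hupow c hc, smul_smul, inv_mul_cancel₀, one_smul]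
      exact mul_ne_zero (Nat.cast_ne_zero.2 (Nat.succ_ne_zero n)) hb
    exact hle (hVtop ▸ Submodule.mem_top)
  · rw [eq_top_iff, ← hVtop, hV, Submodule.span_le]
    rintro _ ⟨c, hc, n, rfl⟩
    induction n with
    | zero =>
      refine mem_maxGenEigenspace_of_eigen ?_
      rw [LinearMap.mulLeft_apply, pow_zero, one_smul, D.mul_smul, huu,
        d_eq_zero he hb hinj hds hN hne huU hc, zero_smul, smul_zero, add_zero, zero_smul]
    | succ n ih =>
      refine mem_maxGenEigenspace_of_sub_mem ?_
      rw [LinearMap.mulLeft_apply, hupow c hc, zero_smul, sub_zero]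
      exact Submodule.smul_mem _ _ ih

end NonCyclic

end RightMulData

end Novikov

end

/-! ### Assembly of the cases. -/

theorem theorem3p4 {F : Type u} [Field F] [CharZero F] [IsAlgClosed F]
    {N : Type v} [LeftPreLieRing N] [LeftPreLieAlgebra F N]
    (hN : Novikov.IsNovikov N)
    (hsimple : Novikov.IsSimple F N)
    (hinf : ¬ FiniteDimensional F N)
    (e : N)
    (hloc : Novikov.IsLocallyFinite (LinearMap.mulLeft F e))
    (hconst : ∃ b : F, LinearMap.mulRight F e = b • LinearMap.id)
    (hsurj : LinearMap.mulRight F e = 0 → Function.Surjective (LinearMap.mulLeft F e)) :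
    ∃ (Δ : AddSubgroup F) (F₁ : Type v) (_ : Field F₁) (_ : Algebra F F₁)
      (f : Δ → Δ → F₁ˣ) (_ : Novikov.IsSymmTwoCocycle f)
      (J : Set ℕ) (hJ : J = {0} ∨ J = Set.univ) (ξ : F)
      (φ : N ≃ₗ[F] Novikov.A Δ F₁ J),
      ∀ u v : N, φ (u * v) = Novikov.circA f ξ hJ (φ u) (φ v) := by
  obtain ⟨b, hconst⟩ := hconst
  have hbe : ∀ x : N, x * e = b • x := fun x => LinearMap.congr_fun hconst x
  by_cases hb : b = 0
  · subst hb
    rw [zero_smul] at hconst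
    exact Novikov.isModelAlgebra_of_mulRight_eq_zero hN hsimple e hloc
      (fun x => by rw [hbe, zero_smul]) (hsurj hconst)
  obtain ⟨C, _, _, _, _, ⟨D⟩⟩ := Novikov.exists_rightMulData F N hN
  have he : D.R e = algebraMap F C b := by
    rw [← sub_eq_zero]
    refine D.faithful _ fun x => ?_
    rw [sub_smul, ← D.mul_eq, hbe, algebraMap_smul, sub_self]
  have hinj := D.eq_zero_of_smul_unit_eq_zero he hb hsimple
  by_cases hne : ∀ x : N, ∃ c : C, c • e = x
  · exact D.isModelAlgebra he hinj hne hsimple hloc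
  -- The element `u` takes over the role of `e`, with zero right multiplication.
  · obtain ⟨u, hu, hus, hut⟩ := Novikov.RightMulData.exists_mulRight_eq_zero he hb hinj
      (fun I hI => hI.eq_bot_or_top he hb hsimple)
      (Novikov.iSup_maxGenEigenspace_eq_top_of_isLocallyFinite hloc)
      (Novikov.iSup_maxGenEigenspace_eq_top_of_isLocallyFinite
        (D.isLocallyFinite_d he hinj hloc)) hne hsimple
    exact Novikov.isModelAlgebra_of_mulRight_eq_zero hN hsimple u
      (Novikov.isLocallyFinite_of_maxGenEigenspace_zero_eq_top hut)
      (fun x => by rw [D.mul_eq, hu, zero_smul]) hus
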